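/- Let $K$ be a field. Let $Q$ be a finite quiver and $I$ an admissible ideal of the path algebra $KQ$ (products of paths are written from left to right) such that (S0) $I$ is generated by paths of length $2$; (S1) for every arrow $a$ of $Q$ there is at most one arrow $b$ with $ab\notin I$ and at most one arrow $c$ with $ca\notin I$. Let $A$ be an almost gentle algebra with this presentation, that is, a finite-dimensional $K$-algebra that is Morita equivalent (over $K$) to $KQ/I$. Let $D(A)=\operatorname{Hom}_K(A,K)$ with its $A$-$A$-bimodule structure $(afb)(x)=f(bxa)$, and let $T(A)=A\ltimes D(A)$ be the trivial extension, that is, the space $A\oplus D(A)$ with the product $(a,f)(b,g)=(ab,ag+fb)$. Then: 1. $T(A)$ is a symmetric algebra: it is finite-dimensional and isomorphic to its $K$-dual as a bimodule. 2. $T(A)$ is special multiserial: it is Morita equivalent (over $K$) to $KQ'/I'$ for some finite quiver $Q'$ and some admissible ideal $I'$ that satisfies (S1). 3. If every vertex of $Q$ is the start or the end of some arrow (for connected $Q$ this only excludes the quiver with one vertex and no arrow), then there is a Brauer configuration $\Gamma$ such that $T(A)$ is Morita equivalent to the Brauer configuration algebra $\Lambda_\Gamma$, and such that $T(A)\cong\Lambda_\Gamma$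 as $K$-algebras if $A\cong KQ/I$. Here a Brauer configuration $\Gamma$ consists of a finite set of vertices, a finite set of labelled polygons, which are multisets of vertices, a multiplicity $\mu(\alpha)\ge 1$ for each vertex $\alpha$, and for each vertex $\alpha$ a cyclic ordering of the polygons that contain $\alpha$, each listed as often as $\alpha$ occurs in it. The number of entries in this list is the valency $\operatorname{val}(\alpha)$. It is required that every vertex lies in a polygon, that every polygon has at least two vertices (with repetition), and that every polygon has a vertex $\alpha$ with $\operatorname{val}(\alpha)\mu(\alpha)>1$. A vertex is truncated if $\operatorname{val}(\alpha)\mu(\alpha)=1$. The quiver $Q_\Gamma$ has the polygons as its vertices and, for each nontruncated vertex $\alpha$ and each place in the cyclic ordering at $\alpha$, an arrow from the polygon at that place to the next one. Going once around the ordering at $\alpha$ from any place gives a special $\alpha$-cycle. Then $\Lambda_\Gamma=KQ_\Gamma/I_\Gamma$, where $I_\Gamma$ is generated by: $C^{\mu(\alpha)}-C'^{\mu(\beta)}$ for a special $\alpha$-cycle $C$ and a special $\beta$-cycle $C'$ that start at the same polygon; $C^{\mu(\alpha)}a$ for a special $\alpha$-cycle $C$ with first arrow $a$; and the products $ab$ of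 arrows such that $b$ is not the arrow that follows $a$ in the cyclic ordering at the vertex of $a$. -/

import Mathlib

universe u

/-! # Path algebras -/

section PathAlgebra

/-- The path algebra `K V` of a quiver on the finite vertex set `V`, written as the direct sum
`⨁_{a, b} e_a (K V) e_b`, where `e_a (K V) e_b` is the vector space with basis the paths from `a`
to `b`. So an element is a finitely supported linear combination of paths. -/
def PathAlgebra (K : Type u) [Field K] (V : Type u) [Quiver.{u} V] : Type u :=
  ∀ a b : V, Quiver.Path a b →₀ K

namespace PathAlgebra

variable {K : Type u} [Field K] {V : Type u} [Quiver.{u} V]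

noncomputable instance : AddCommGroup (PathAlgebra K V) :=
  inferInstanceAs (AddCommGroup (∀ a b : V, Quiver.Path a b →₀ K))

noncomputable instance : Module K (PathAlgebra K V) :=
  inferInstanceAs (Module K (∀ a b : V, Quiver.Path a b →₀ K))

open Classical in
/-- The basis element of the path algebra given by a path. -/
noncomputable def ofPath {a b : V} (p : Quiver.Path a b) : PathAlgebra K V :=
  Pi.single a (Pi.single b (Finsupp.single p 1))

/-- The element of the path algebra given by an arrow. -/
noncomputable def ofArrow {a b : V} (e : a ⟶ b) : PathAlgebra K V := ofPath e.toPath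

/-- Bilinear extension of the concatenation of paths (`p` followed by `q`). -/
noncomputable def concat (a b c : V) :
    (Quiver.Path a b →₀ K) →ₗ[K] (Quiver.Path b c →₀ K) →ₗ[K] (Quiver.Path a c →₀ K) :=
  Finsupp.lift _ K _ fun p => Finsupp.lmapDomain K K fun q => p.comp q

theorem concat_single {a b c : V} (p : Quiver.Path a b) (q : Quiver.Path b c) (x y : K) :
    concat a b c (Finsupp.single p x) (Finsupp.single q y) = Finsupp.single (p.comp q) (x * y) := by
  simp [concat]

theorem concat_assoc {a b c d : V} (f : Quiver.Path a b →₀ K) (g : Quiver.Path b c →₀ K)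
    (h : Quiver.Path c d →₀ K) :
    concat a c d (concat a b c f g) h = concat a b d f (concat b c d g h) := by
  induction f using Finsupp.induction_linear with
  | zero => simp
  | add f₁ f₂ h₁ h₂ => simp [h₁, h₂]
  | single p x =>
    induction g using Finsupp.induction_linear with
    | zero => simp
    | add g₁ g₂ h₁ h₂ => simp [h₁, h₂]
    | single q y =>
      induction h using Finsupp.induction_linear with
      | zero => simp
      | add g₁ g₂ h₁ h₂ => simp [h₁, h₂]
      | single r z => simp only [concat_single, Quiver.Path.comp_assoc, mul_assoc]

theorem nil_concat {a b : V} (f : Quiver.Path a b →₀ K) :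
    concat a a b (Finsupp.single Quiver.Path.nil 1) f = f := by
  induction f using Finsupp.induction_linear with
  | zero => simp
  | add f₁ f₂ h₁ h₂ => simp only [map_add, h₁, h₂]
  | single p x => simp [concat_single]

theorem concat_nil {a b : V} (f : Quiver.Path a b →₀ K) :
    concat a b b f (Finsupp.single Quiver.Path.nil 1) = f := by
  induction f using Finsupp.induction_linear with
  | zero => simp
  | add f₁ f₂ h₁ h₂ => simp only [map_add, LinearMap.add_apply, h₁, h₂]
  | single p x => simp [concat_single]

theorem add_apply (f g : PathAlgebra K V) (a c : V) : (f + g) a c = f a c + g a c := rfl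

theorem smul_apply (k : K) (g : PathAlgebra K V) (a c : V) : (k • g) a c = k • g a c := rfl

theorem zero_apply (a c : V) : (0 : PathAlgebra K V) a c = 0 := rfl

open Classical in
/-- The unit is the sum of the trivial paths. -/
noncomputable instance : One (PathAlgebra K V) :=
  ⟨fun a => Pi.single a (Finsupp.single Quiver.Path.nil 1)⟩

open Classical in
theorem one_apply (a : V) :
    (1 : PathAlgebra K V) a = Pi.single a (Finsupp.single Quiver.Path.nil 1) := rfl

variable [Fintype V]

/-- The product of two paths is their concatenation, and zero if they do not compose. -/
noncomputable instance : Mul (PathAlgebra K V) :=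
  ⟨fun f g a c => ∑ b, concat a b c (f a b) (g b c)⟩

theorem mul_apply (f g : PathAlgebra K V) (a c : V) :
    (f * g) a c = ∑ b, concat a b c (f a b) (g b c) := rfl

noncomputable instance : Ring (PathAlgebra K V) :=
  { (inferInstance : AddCommGroup (PathAlgebra K V)),
    (inferInstance : Mul (PathAlgebra K V)),
    (inferInstance : One (PathAlgebra K V)) with
    left_distrib := fun f g h => by
      funext a c
      simp [mul_apply, add_apply, Finset.sum_add_distrib]
    right_distrib := fun f g h => by
      funext a c
      simp [mul_apply, add_apply, Finset.sum_add_distrib]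
    zero_mul := fun f => by
      funext a c
      simp [mul_apply, zero_apply]
    mul_zero := fun f => by
      funext a c
      simp [mul_apply, zero_apply]
    mul_assoc := fun f g h => by
      funext a d
      simp only [mul_apply, map_sum, LinearMap.sum_apply, concat_assoc]
      exact Finset.sum_comm
    one_mul := fun f => by
      classical
      funext a c
      rw [mul_apply, Finset.sum_eq_single a]
      · simp [one_apply, nil_concat]
      · intro b _ hb
        simp [one_apply, hb]
      · simp
    mul_one := fun f => by
      classical
      funext a c
      rw [mul_apply, Finset.sum_eq_single c]
      · simp [one_apply, concat_nil]
      · intro b _ hb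
        simp [one_apply, Ne.symm hb]
      · simp }

noncomputable instance : Algebra K (PathAlgebra K V) :=
  Algebra.ofModule
    (fun k f g => by
      funext a c
      simp [mul_apply, smul_apply, Finset.smul_sum])
    (fun k f g => by
      funext a c
      simp [mul_apply, smul_apply, Finset.smul_sum])

theorem ofPath_mul_ofPath {a b c : V} (p : Quiver.Path a b) (q : Quiver.Path b c) :
    (ofPath p * ofPath q : PathAlgebra K V) = ofPath (p.comp q) := by
  classical
  funext x y
  rw [mul_apply, Finset.sum_eq_single b]
  · by_cases hx : x = a
    · subst hx
      by_cases hy : y = c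
      · subst hy
        simp [ofPath, concat_single]
      · simp [ofPath, hy]
    · simp [ofPath, hx]
  · intro z _ hz
    simp [ofPath, Pi.single_eq_of_ne hz]
  · simp

theorem ofPath_mul_ofPath_of_ne {a b c d : V} (p : Quiver.Path a b) (q : Quiver.Path c d)
    (h : b ≠ c) : (ofPath p * ofPath q : PathAlgebra K V) = 0 := by
  classical
  funext x y
  rw [mul_apply, zero_apply]
  refine Finset.sum_eq_zero fun z _ => ?_
  by_cases hz : z = c
  · subst hz
    by_cases hx : x = a
    · subst hx
      simp [ofPath, Pi.single_eq_of_ne h.symm]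
    · simp [ofPath, hx]
  · simp [ofPath, hz]

end PathAlgebra

end PathAlgebra

/-! # Ideals of relations; special multiserial and almost gentle algebras -/

section Relations

variable {K : Type u} [Field K] {V : Type u} [Quiver.{u} V] [Fintype V]

/-- The quotient `K V / I` of the path algebra by a two-sided ideal. -/
abbrev QuiverAlgebra (I : TwoSidedIdeal (PathAlgebra K V)) : Type u := I.ringCon.Quotient

variable (K V) in
/-- The `n`-th power of the arrow ideal: the ideal generated by the paths of length at
least `n`. -/
noncomputable def arrowIdealPow (n : ℕ) : TwoSidedIdeal (PathAlgebra K V) :=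
  TwoSidedIdeal.span
    {x | ∃ (a b : V) (p : Quiver.Path a b), n ≤ p.length ∧ x = PathAlgebra.ofPath p}

/-- `I` is admissible: it lies between some power of the arrow ideal and the square of the arrow
ideal. -/
def IsAdmissibleIdeal (I : TwoSidedIdeal (PathAlgebra K V)) : Prop :=
  I ≤ arrowIdealPow K V 2 ∧ ∃ n, 2 ≤ n ∧ arrowIdealPow K V n ≤ I

/-- `I` is generated by paths of length two. -/
def IsQuadraticMonomialIdeal (I : TwoSidedIdeal (PathAlgebra K V)) : Prop :=
  ∃ S : Set (PathAlgebra K V),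
    (∀ x ∈ S, ∃ (a b : V) (p : Quiver.Path a b), p.length = 2 ∧ x = PathAlgebra.ofPath p) ∧
    I = TwoSidedIdeal.span S

/-- For every arrow `a` there is at most one arrow `b` with `ab ∉ I` and at most one arrow `c`
with `ca ∉ I`. -/
def IsSpecialMultiserialIdeal (I : TwoSidedIdeal (PathAlgebra K V)) : Prop :=
  ∀ (v w : V) (a : v ⟶ w),
    (∀ b b' : (Σ x : V, (w ⟶ x)),
      PathAlgebra.ofArrow a * PathAlgebra.ofArrow b.2 ∉ I →
      PathAlgebra.ofArrow a * PathAlgebra.ofArrow b'.2 ∉ I → b = b') ∧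
    (∀ c c' : (Σ x : V, (x ⟶ v)),
      PathAlgebra.ofArrow c.2 * PathAlgebra.ofArrow a ∉ I →
      PathAlgebra.ofArrow c'.2 * PathAlgebra.ofArrow a ∉ I → c = c')

/-- The pair formed by the quiver on `V` and the ideal `I` is an almost gentle presentation. -/
structure IsAlmostGentleIdeal (I : TwoSidedIdeal (PathAlgebra K V)) : Prop where
  finite_arrows : ∀ a b : V, Finite (a ⟶ b)
  admissible : IsAdmissibleIdeal I
  quadratic : IsQuadraticMonomialIdeal I
  multiserial : IsSpecialMultiserialIdeal I

end Relations

/-- A `K`-algebra is special multiserial if it is Morita equivalent to some `K V / I` with a finite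
quiver on `V` and an admissible ideal `I` such that every arrow `a` has at most one arrow `b` with
`ab ∉ I` and at most one arrow `c` with `ca ∉ I`. -/
def IsSpecialMultiserialAlgebra (K : Type u) [Field K] (A : Type u) [Ring A] [Algebra K A] :
    Prop :=
  ∃ (V : Type u) (_ : Quiver.{u} V) (_ : Fintype V) (I : TwoSidedIdeal (PathAlgebra K V)),
    (∀ a b : V, Finite (a ⟶ b)) ∧ IsAdmissibleIdeal I ∧ IsSpecialMultiserialIdeal I ∧
    IsMoritaEquivalent K A (QuiverAlgebra I)

/-! # The dual bimodule, trivial extensions and symmetric algebras -/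

section TrivialExtension

/-- The dual space `D(A) = Hom_K(A, K)`, to be regarded as an `A`-`A`-bimodule. -/
def DualBimodule (K : Type u) [Field K] (A : Type u) [Ring A] [Algebra K A] : Type u :=
  Module.Dual K A

namespace DualBimodule

variable {K : Type u} [Field K] {A : Type u} [Ring A] [Algebra K A]

instance : AddCommGroup (DualBimodule K A) := inferInstanceAs (AddCommGroup (Module.Dual K A))

instance : Module K (DualBimodule K A) := inferInstanceAs (Module K (Module.Dual K A))

instance : FunLike (DualBimodule K A) A K := inferInstanceAs (FunLike (Module.Dual K A) A K)

instance : LinearMapClass (DualBimodule K A) K A K :=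
  inferInstanceAs (LinearMapClass (Module.Dual K A) K A K)

@[ext] theorem ext {f g : DualBimodule K A} (h : ∀ x, f x = g x) : f = g := LinearMap.ext h

@[simp] theorem add_apply (f g : DualBimodule K A) (x : A) : (f + g) x = f x + g x := rfl

@[simp] theorem zero_apply (x : A) : (0 : DualBimodule K A) x = 0 := rfl

@[simp] theorem base_smul_apply (k : K) (f : DualBimodule K A) (x : A) :
    (k • f) x = k * f x := rfl

/-- Left action: `(a f)(x) = f (x a)`. -/
instance : SMul A (DualBimodule K A) :=
  ⟨fun a f => LinearMap.comp (f : Module.Dual K A) (LinearMap.mulRight K a)⟩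

/-- Right action: `(f b)(x) = f (b x)`. -/
instance : SMul Aᵐᵒᵖ (DualBimodule K A) :=
  ⟨fun b f => LinearMap.comp (f : Module.Dual K A) (LinearMap.mulLeft K b.unop)⟩

theorem smul_apply (a : A) (f : DualBimodule K A) (x : A) : (a • f) x = f (x * a) := rfl

theorem op_smul_apply (b : Aᵐᵒᵖ) (f : DualBimodule K A) (x : A) :
    (b • f) x = f (b.unop * x) := rfl

instance : Module A (DualBimodule K A) where
  one_smul f := by ext x; simp [smul_apply]
  mul_smul a b f := by ext x; simp [smul_apply, mul_assoc]
  smul_zero a := by ext x; simp [smul_apply]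
  smul_add a f g := by ext x; simp [smul_apply]
  add_smul a b f := by ext x; simp [smul_apply, mul_add]
  zero_smul f := by ext x; simp [smul_apply]

instance : Module Aᵐᵒᵖ (DualBimodule K A) where
  one_smul f := by ext x; simp [op_smul_apply]
  mul_smul a b f := by ext x; simp [op_smul_apply, mul_assoc]
  smul_zero a := by ext x; simp [op_smul_apply]
  smul_add a f g := by ext x; simp [op_smul_apply]
  add_smul a b f := by ext x; simp [op_smul_apply, add_mul]
  zero_smul f := by ext x; simp [op_smul_apply]

instance : SMulCommClass A Aᵐᵒᵖ (DualBimodule K A) where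
  smul_comm a b f := by ext x; simp [op_smul_apply, smul_apply, mul_assoc]

instance : IsScalarTower K A (DualBimodule K A) where
  smul_assoc k a f := by ext x; simp [smul_apply]

instance : IsScalarTower K Aᵐᵒᵖ (DualBimodule K A) where
  smul_assoc k a f := by ext x; simp [op_smul_apply]

end DualBimodule

/-- The trivial extension `T(A) = A ⋉ D(A)`: the space `A × D(A)` with the product
`(a, f) (b, g) = (a b, a g + f b)`. -/
abbrev TrivialExtension (K : Type u) [Field K] (A : Type u) [Ring A] [Algebra K A] : Type u :=
  TrivSqZeroExt A (DualBimodule K A)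

/-- A finite-dimensional `K`-algebra `A` is symmetric if `A` and `D(A)` are isomorphic as
`A`-`A`-bimodules. -/
def IsSymmetricKAlgebra (K : Type u) [Field K] (A : Type u) [Ring A] [Algebra K A] : Prop :=
  Module.Finite K A ∧
  ∃ φ : A ≃ₗ[K] DualBimodule K A,
    ∀ a x b : A, φ (a * x * b) = a • (MulOpposite.op b • φ x)

end TrivialExtension

/-! # Brauer configurations and their algebras -/

/-- A Brauer configuration. The polygons are labelled by the elements of the type `Polygon`, so
distinct polygons may be equal as multisets. -/
structure BrauerConfiguration : Type (u + 1) where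
  /-- the vertices -/
  Vertex : Type u
  /-- the labels of the polygons -/
  Polygon : Type u
  [fintypeVertex : Fintype Vertex]
  [fintypePolygon : Fintype Polygon]
  [decEqVertex : DecidableEq Vertex]
  [decEqPolygon : DecidableEq Polygon]
  /-- each polygon is a multiset of vertices -/
  poly : Polygon → Multiset Vertex
  /-- the multiplicity function -/
  mult : Vertex → ℕ
  mult_pos : ∀ α, 0 < mult α
  /-- The orientation: the cyclic ordering of the polygons at a vertex `α`, written as a list
  `V₁ < V₂ < ⋯ < Vₜ (< V₁)` from some starting point. -/
  orient : Vertex → List Polygon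
  /-- a polygon is listed at `α` as often as `α` occurs in it -/
  count_orient : ∀ α V, (orient α).count V = (poly V).count α
  /-- every vertex lies in a polygon -/
  vertex_mem : ∀ α, ∃ V, α ∈ poly V
  /-- every polygon has at least two vertices, counted with repetition -/
  two_le_card : ∀ V, 2 ≤ Multiset.card (poly V)
  /-- every polygon has a vertex `α` with `val(α) μ(α) > 1` -/
  exists_nontruncated :
    ∀ V, ∃ α ∈ poly V, 1 < (∑ W, (poly W).count α) * mult α

namespace BrauerConfiguration

attribute [instance] fintypeVertex fintypePolygon decEqVertex decEqPolygon

variable (Γ : BrauerConfiguration.{u})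

/-- The valency of a vertex: the number of its occurrences in polygons. -/
def val (α : Γ.Vertex) : ℕ := ∑ V, (Γ.poly V).count α

/-- A vertex is truncated if its valency and its multiplicity are one. -/
def IsTruncated (α : Γ.Vertex) : Prop := Γ.val α * Γ.mult α = 1

/-- The arrows of the quiver of `Γ`: one for each place in the cyclic ordering at each
nontruncated vertex. -/
def Arrow : Type u := Σ α : {α : Γ.Vertex // ¬ Γ.IsTruncated α}, Fin (Γ.orient α).length

variable {Γ}

/-- The arrow that follows `x` in the cyclic ordering at the vertex of `x`. -/
def next (x : Γ.Arrow) : Γ.Arrow := ⟨x.1, finRotate _ x.2⟩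

/-- The polygon at which the arrow `x` starts. -/
def src (x : Γ.Arrow) : Γ.Polygon := (Γ.orient x.1).get x.2

/-- The polygon at which the arrow `x` ends: the successor of its source at the vertex of `x`. -/
def tgt (x : Γ.Arrow) : Γ.Polygon := src (next x)

variable (Γ) in
/-- The vertices of the quiver of `Γ` are the polygons. -/
def QuiverVertex : Type u := Γ.Polygon

instance : Fintype Γ.QuiverVertex := inferInstanceAs (Fintype Γ.Polygon)

/-- The quiver of `Γ`. -/
instance : Quiver.{u} Γ.QuiverVertex where
  Hom V W := {x : Γ.Arrow // src x = V ∧ tgt x = W}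

variable (K : Type u) [Field K]

/-- An arrow as an element of the path algebra. -/
noncomputable def arrowElt (x : Γ.Arrow) : PathAlgebra K Γ.QuiverVertex :=
  PathAlgebra.ofArrow (V := Γ.QuiverVertex) (a := src x) (b := tgt x) ⟨x, rfl, rfl⟩

/-- The special cycle that starts with the arrow `x`: it runs once through all the arrows at the
vertex of `x`. -/
noncomputable def specialCycle (x : Γ.Arrow) : PathAlgebra K Γ.QuiverVertex :=
  ((List.range (Γ.orient x.1).length).map fun k => arrowElt K (next^[k] x)).prod

variable (Γ)

/-- The first kind of relation: `C^{μ(α)} - C'^{μ(β)}` for special cycles `C` at `α` and `C'` at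
`β` that start at the same polygon. -/
def relationsOne : Set (PathAlgebra K Γ.QuiverVertex) :=
  {r | ∃ x y : Γ.Arrow, src x = src y ∧
    r = specialCycle K x ^ Γ.mult x.1 - specialCycle K y ^ Γ.mult y.1}

/-- The second kind of relation: `C^{μ(α)} a` for a special cycle `C` at `α` with first
arrow `a`. -/
def relationsTwo : Set (PathAlgebra K Γ.QuiverVertex) :=
  {r | ∃ x : Γ.Arrow, r = specialCycle K x ^ Γ.mult x.1 * arrowElt K x}

/-- The third kind of relation: products `a b` of arrows that do not follow each other in a special
cycle, that is, `a b` is not a subpath of a special cycle, and it is not the square of a loop at a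
vertex of valency one and multiplicity greater than one (for such a loop `next a = a`). -/
def relationsThree : Set (PathAlgebra K Γ.QuiverVertex) :=
  {r | ∃ x y : Γ.Arrow, y ≠ next x ∧ r = arrowElt K x * arrowElt K y}

/-- The ideal of relations of the Brauer configuration algebra. -/
noncomputable def ideal : TwoSidedIdeal (PathAlgebra K Γ.QuiverVertex) :=
  TwoSidedIdeal.span (Γ.relationsOne K ∪ Γ.relationsTwo K ∪ Γ.relationsThree K)

/-- The Brauer configuration algebra of `Γ`. -/
abbrev algebra : Type u := QuiverAlgebra (Γ.ideal K)

end BrauerConfiguration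

/-! Symmetry of `T(A)` needs no presentation: the form `⟨(a, f), (b, g)⟩ = f(b) + g(a)` is
symmetric, associative and nondegenerate on the trivial extension of any finite-dimensional algebra.

The other claims are first reduced to `A = KQ/I`. Morita equivalent algebras are full corners of a
common linking algebra `L` (`IsMoritaEquivalent.exists_fullCorner`). If `S = eRe` is a full corner
of `R`, then `T(S)` is a full corner of `T(R)`, because `e D(R) e = D(eRe)`. A full corner is Morita
equivalent to the whole ring, so `T` preserves Morita equivalence.

For `A = KQ/I` the nonzero paths form a basis. By (S1) an arrow has at most one continuation in each
direction, and by admissibility the continuations end. Hence every arrow lies on exactly one maximal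
path `p`, at one place, and every nontrivial nonzero path is an interval of one such `p`
(`IsAlmostGentleIdeal.nonempty_chainData`). Close up each `p` to a cycle by one new arrow from its
end to its start, with a loop at each isolated vertex. Send the old arrows to themselves and the new
arrow to the dual basis element of `p`. Multiplying this functional by arrows shortens the path that
it detects, so an interval of the cycle through the new arrow becomes the dual of the complementary
interval (`cyc_theta_of_lt`). In particular a full cycle becomes the dual of a trivial path and
depends only on its base vertex. This gives the relations of a Brauer configuration algebra with all
multiplicities one.

The resulting homomorphism onto `T(KQ/I)` is injective: the form `tau`, evaluation of the functional
at 1, pairs the spanning family of intervals with the family of complementary intervals in the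
identity matrix (`tau_family_mul_dualFamily`). Special multiseriality is read off from the
relations. The Brauer configuration has the vertices of `Q` as polygons and the maximal paths as
vertices, together with one truncated vertex for each polygon. -/

/-! # Full corners and Morita equivalence -/

section FullCorner

open CategoryTheory

/-- A realization of the algebra `S` as a corner `e R e` for a full idempotent `e` of `R`. -/
structure FullCorner (K : Type u) [Field K] (S R : Type u) [Ring S] [Algebra K S]
    [Ring R] [Algebra K R] where
  /-- the embedding of `S` onto `e R e` -/
  emb : S →ₗ[K] R
  emb_mul : ∀ s t, emb (s * t) = emb s * emb t
  emb_injective : Function.Injective emb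
  /-- the compression `r ↦ e r e` -/
  comp : R →ₗ[K] S
  emb_comp : ∀ r, emb (comp r) = emb 1 * r * emb 1
  /-- the number of terms in a decomposition of the unit -/
  num : ℕ
  /-- the left factors of a decomposition of the unit -/
  left : Fin num → R
  /-- the right factors of a decomposition of the unit -/
  right : Fin num → R
  sum_eq_one : ∑ i, left i * emb 1 * right i = 1

namespace FullCorner

variable {K : Type u} [Field K] {S R : Type u} [Ring S] [Algebra K S] [Ring R] [Algebra K R]
  (c : FullCorner K S R)

/-- The idempotent of a corner. -/
def idem : R := c.emb 1

theorem emb_one : c.emb 1 = c.idem := rfl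

theorem idem_mul_emb (s : S) : c.idem * c.emb s = c.emb s := by
  rw [idem, ← c.emb_mul, one_mul]

theorem emb_mul_idem (s : S) : c.emb s * c.idem = c.emb s := by
  rw [idem, ← c.emb_mul, mul_one]

theorem idem_mul_idem : c.idem * c.idem = c.idem := c.idem_mul_emb 1

theorem comp_emb (s : S) : c.comp (c.emb s) = s := by
  apply c.emb_injective
  rw [c.emb_comp, emb_one, idem_mul_emb, emb_mul_idem]

theorem emb_mul_comp (s : S) (r : R) : c.comp (c.emb s * r) = s * c.comp r := by
  apply c.emb_injective
  rw [c.emb_comp, c.emb_mul, c.emb_comp, ← mul_assoc, ← mul_assoc, ← mul_assoc, emb_one,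
    idem_mul_emb, emb_mul_idem]

theorem comp_mul_emb (s : S) (r : R) : c.comp (r * c.emb s) = c.comp r * s := by
  apply c.emb_injective
  rw [c.emb_comp, c.emb_mul, c.emb_comp, mul_assoc, mul_assoc, mul_assoc, mul_assoc, emb_one,
    idem_mul_emb, emb_mul_idem]

section Modules

variable (M : Type u) [AddCommGroup M] [Module R M]

/-- The subgroup `e M` of an `R`-module. -/
def part : AddSubgroup M where
  carrier := {m | c.idem • m = m}
  add_mem' {a b} ha hb := by
    change c.idem • (a + b) = a + b
    rw [smul_add, show c.idem • a = a from ha, show c.idem • b = b from hb]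
  zero_mem' := smul_zero _
  neg_mem' {a} ha := by
    change c.idem • (-a) = -a
    rw [smul_neg, show c.idem • a = a from ha]

variable {M}

theorem mem_part {m : M} : m ∈ c.part M ↔ c.idem • m = m := Iff.rfl

theorem emb_smul_mem (s : S) (m : M) : c.emb s • m ∈ c.part M := by
  rw [mem_part, ← mul_smul, idem_mul_emb]

variable (M)

/-- The subgroup `e M` is a module over the corner. -/
instance partModule : Module S (c.part M) where
  smul s m := ⟨c.emb s • (m : M), c.emb_smul_mem s m.val⟩
  one_smul m := Subtype.ext m.2
  mul_smul s t m := Subtype.ext (by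
    change c.emb (s * t) • (m : M) = c.emb s • c.emb t • (m : M)
    rw [c.emb_mul, mul_smul])
  smul_zero s := Subtype.ext (smul_zero _)
  smul_add s m n := Subtype.ext (smul_add _ _ _)
  add_smul s t m := Subtype.ext (by
    change c.emb (s + t) • (m : M) = c.emb s • (m : M) + c.emb t • (m : M)
    rw [map_add, add_smul])
  zero_smul m := Subtype.ext (by
    change c.emb 0 • (m : M) = 0
    rw [map_zero, zero_smul])

variable {M}

theorem coe_smul (s : S) (m : c.part M) : (s • m).val = c.emb s • (m : M) := rfl

/-- A homomorphism of `R`-modules restricts to the corner. -/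
def partMap {N : Type u} [AddCommGroup N] [Module R N] (f : M →ₗ[R] N) :
    c.part M →ₗ[S] c.part N where
  toFun m := ⟨f m, by rw [mem_part, ← map_smul, c.mem_part.1 m.2]⟩
  map_add' m n := Subtype.ext (map_add f _ _)
  map_smul' s m := Subtype.ext (map_smul f (c.emb s) (m : M))

/-- The projection `m ↦ e m`. -/
def proj : M →+ c.part M where
  toFun m := ⟨c.idem • m, c.emb_smul_mem 1 m⟩
  map_zero' := Subtype.ext (smul_zero _)
  map_add' _ _ := Subtype.ext (smul_add _ _ _)

theorem coe_proj (m : M) : (c.proj m : M) = c.idem • m := rfl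

theorem idem_smul_coe (m : c.part M) : c.idem • (m : M) = m := m.2

/-- If `e m = m`, then `e r m = (e r e) m`: compressing the action of any `r` to `e M` is an action
of the corner, through which `S`-linear maps can pass. -/
theorem proj_smul_coe (r : R) (m : c.part M) : c.proj (r • (m : M)) = c.comp r • m := by
  apply Subtype.ext
  rw [coe_smul, c.emb_comp, emb_one, mul_smul, idem_smul_coe, mul_smul, coe_proj]

end Modules

/-- The functor `M ↦ e M`. -/
def functor : ModuleCat.{u} R ⥤ ModuleCat.{u} S where
  obj M := ModuleCat.of S (c.part M)
  map f := ModuleCat.ofHom (c.partMap f.hom)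

/-- Fullness on modules: every `m` is rebuilt from the elements `e rᵢ m`. Hence `R`-linear maps are
determined by their restrictions to `e M` and can be constructed from them. -/
theorem sum_smul_eq {M : Type u} [AddCommGroup M] [Module R M] (m : M) :
    ∑ i, c.left i • c.idem • c.right i • m = m := by
  conv_rhs => rw [← one_smul R m, ← c.sum_eq_one]
  simp [Finset.sum_smul, mul_smul, emb_one]

instance : c.functor.Faithful where
  map_injective {M N} f g h := by
    ext m
    have key : ∀ x ∈ c.part M, f.hom x = g.hom x := fun x hx =>
      congrArg Subtype.val (LinearMap.congr_fun (ModuleCat.hom_ext_iff.1 h) ⟨x, hx⟩)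
    have h2 : ∀ x : M, f.hom (c.idem • x) = g.hom (c.idem • x) :=
      fun x => key _ (c.emb_smul_mem 1 x)
    rw [← c.sum_smul_eq m, map_sum, map_sum]
    refine Finset.sum_congr rfl fun i _ => ?_
    rw [map_smul, map_smul g.hom, ← h2]

/-- The extension to `R`-modules of a homomorphism between their corners. -/
def extend {M N : Type u} [AddCommGroup M] [Module R M] [AddCommGroup N] [Module R N]
    (g : c.part M →ₗ[S] c.part N) : M →ₗ[R] N where
  toFun m := ∑ i, c.left i • (g (c.proj (c.right i • m)) : N)
  map_add' m n := by
    rw [← Finset.sum_add_distrib]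
    refine Finset.sum_congr rfl fun i _ => ?_
    rw [← smul_add, smul_add, map_add, map_add, AddSubgroup.coe_add]
  map_smul' r m := by
    -- The element `e rᵢ r m` expands as `∑ⱼ (e rᵢ r lⱼ e)(e rⱼ m)`. The coefficients come from `S`,
    -- so `g` commutes with them; summation over `i` then restores the factor `r lⱼ`.
    have h : ∀ i, (g (c.proj (c.right i • r • m)) : N) =
        ∑ j, (c.idem * (c.right i * r * c.left j) * c.idem) • (g (c.proj (c.right j • m)) : N) := by
      intro i
      have h1 : c.proj (c.right i • r • m) =
          ∑ j, c.comp (c.right i * r * c.left j) • c.proj (c.right j • m) := by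
        conv_lhs => rw [← c.sum_smul_eq m]
        rw [Finset.smul_sum, Finset.smul_sum, map_sum]
        refine Finset.sum_congr rfl fun j _ => ?_
        rw [← c.proj_smul_coe, coe_proj, mul_smul, mul_smul]
      rw [h1, map_sum, AddSubgroup.val_finsetSum]
      refine Finset.sum_congr rfl fun j _ => ?_
      rw [map_smul, coe_smul, c.emb_comp, emb_one]
    simp only [h, RingHom.id_apply]
    simp only [Finset.smul_sum]
    rw [Finset.sum_comm]
    refine Finset.sum_congr rfl fun j _ => ?_
    rw [← mul_smul, ← c.sum_smul_eq ((r * c.left j) • (g (c.proj (c.right j • m)) : N))]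
    refine Finset.sum_congr rfl fun i _ => ?_
    conv_rhs => rw [← c.idem_smul_coe (g (c.proj (c.right j • m)))]
    simp only [← mul_smul, mul_assoc]

theorem extend_coe {M N : Type u} [AddCommGroup M] [Module R M] [AddCommGroup N] [Module R N]
    (g : c.part M →ₗ[S] c.part N) (m : c.part M) : c.extend g m = g m := by
  change ∑ i, c.left i • (g (c.proj (c.right i • (m : M))) : N) = (g m : N)
  rw [← c.sum_smul_eq (g m : N)]
  refine Finset.sum_congr rfl fun i _ => ?_
  rw [proj_smul_coe, map_smul, ← proj_smul_coe, coe_proj]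

instance : c.functor.Full where
  map_surjective {M N} g := by
    refine ⟨ModuleCat.ofHom (c.extend g.hom), ?_⟩
    apply ModuleCat.hom_ext
    exact LinearMap.ext fun m => Subtype.ext (c.extend_coe g.hom m)

/-- The left `S`-module `e R`. -/
abbrev row : Type u := c.part R

theorem row_mul_mem (x : c.row) (r : R) : (x : R) * r ∈ c.part R := by
  rw [mem_part, smul_eq_mul, ← mul_assoc]
  exact congrArg (· * r) (c.mem_part.1 x.2)

/-- Right multiplication on `e R`. -/
def rowMul : Rᵐᵒᵖ →+* Module.End S c.row where
  toFun r :=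
    { toFun x := ⟨x * r.unop, c.row_mul_mem x r.unop⟩
      map_add' _ _ := Subtype.ext (add_mul _ _ _)
      map_smul' _ _ := Subtype.ext (mul_assoc _ _ _) }
  map_one' := LinearMap.ext fun x => Subtype.ext (mul_one (x : R))
  map_mul' r t := LinearMap.ext fun x => Subtype.ext (mul_assoc (x : R) t.unop r.unop).symm
  map_zero' := LinearMap.ext fun x => Subtype.ext (mul_zero (x : R))
  map_add' r t := LinearMap.ext fun x => Subtype.ext (mul_add (x : R) r.unop t.unop)

theorem coe_rowMul (r : R) (x : c.row) : (c.rowMul (.op r) x : R) = x * r := rfl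

/-- The `R`-module coinduced from an `S`-module along the corner. -/
def Coind (N : Type u) [AddCommGroup N] [Module S N] : Type u :=
  c.row →ₗ[S] N

section Coind

variable (N : Type u) [AddCommGroup N] [Module S N]

instance : AddCommGroup (c.Coind N) := inferInstanceAs (AddCommGroup (c.row →ₗ[S] N))

variable {N} in
/-- Evaluation of an element of the coinduced module. -/
def Coind.eval (φ : c.Coind N) : c.row →ₗ[S] N := φ

instance : Module R (c.Coind N) where
  smul r φ := (Coind.eval c φ).comp (c.rowMul (.op r))
  one_smul φ := by
    change (Coind.eval c φ).comp (c.rowMul (.op 1)) = φ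
    rw [MulOpposite.op_one, map_one]; rfl
  mul_smul r t φ := by
    change (Coind.eval c φ).comp (c.rowMul (.op (r * t))) = _
    rw [MulOpposite.op_mul, map_mul]; rfl
  smul_zero r := rfl
  smul_add r φ ψ := rfl
  add_smul r t φ := by
    change (Coind.eval c φ).comp (c.rowMul (.op (r + t))) = _
    rw [MulOpposite.op_add, map_add]; exact LinearMap.comp_add _ _ _
  zero_smul φ := by
    change (Coind.eval c φ).comp (c.rowMul (.op 0)) = _
    rw [MulOpposite.op_zero, map_zero]; exact LinearMap.comp_zero _

theorem Coind.eval_smul (r : R) (φ : c.Coind N) (x : c.row) :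
    Coind.eval c (r • φ) x = Coind.eval c φ (c.rowMul (.op r) x) := rfl

/-- The idempotent as an element of `e R`. -/
def unit : c.row := ⟨c.idem, c.idem_mul_idem⟩

/-- For `x` in `eR` one has `x e = e x e`. So an element of the `e`-part of `Hom_S(eR, N)`, which
satisfies `φ(x e) = φ(x)`, is determined by its value at `e`. -/
theorem rowMul_idem (x : c.row) : c.rowMul (.op c.idem) x = c.comp x • c.unit := by
  apply Subtype.ext
  rw [coe_smul, c.emb_comp, emb_one, coe_rowMul]
  change _ = c.idem * x * c.idem * c.idem
  rw [mul_assoc _ c.idem c.idem, idem_mul_idem, show c.idem * (x : R) = x from x.2]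

theorem comp_idem : c.comp c.idem = 1 := c.comp_emb 1

/-- The corner of a coinduced module is the module that one started with. -/
def partCoind : c.part (c.Coind N) ≃ₗ[S] N where
  toFun φ := Coind.eval c φ.val c.unit
  map_add' _ _ := rfl
  map_smul' s φ := by
    rw [coe_smul, Coind.eval_smul, RingHom.id_apply, ← map_smul]
    congr 1
    apply Subtype.ext
    rw [coe_rowMul, coe_smul]
    exact (c.idem_mul_emb s).trans (c.emb_mul_idem s).symm
  invFun n := ⟨({ toFun := fun x => c.comp x • n
                  map_add' := fun x y => by
                    rw [AddSubgroup.coe_add, map_add, add_smul]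
                  map_smul' := fun s x => by
                    rw [coe_smul, smul_eq_mul, c.emb_mul_comp, mul_smul]
                    rfl } : c.row →ₗ[S] N), by
    refine LinearMap.ext fun x => ?_
    change c.comp (x * c.idem) • n = c.comp x • n
    rw [← c.emb_one, c.comp_mul_emb, mul_one]⟩
  left_inv φ := by
    apply Subtype.ext
    refine LinearMap.ext fun x => ?_
    change c.comp x • Coind.eval c φ.val c.unit = Coind.eval c φ.val x
    rw [← map_smul, ← rowMul_idem, ← Coind.eval_smul]
    exact congrArg (fun ψ => Coind.eval c ψ x) φ.2
  right_inv n := by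
    change c.comp c.idem • n = n
    rw [comp_idem, one_smul]

end Coind

instance : c.functor.EssSurj where
  mem_essImage N := ⟨ModuleCat.of R (c.Coind N), ⟨(c.partCoind N).toModuleIso⟩⟩

instance : c.functor.IsEquivalence where

open scoped ModuleCat.Algebra in
instance : c.functor.Linear K where
  map_smul {M N} f k := by
    apply ModuleCat.hom_ext
    refine LinearMap.ext fun m => Subtype.ext ?_
    change (algebraMap K R k) • (f.hom (Subtype.val m)) =
      c.emb (algebraMap K S k) • (f.hom (Subtype.val m))
    -- A scalar `k` of the corner acts as `emb (k 1) = k e`, and `e` is the identity on `e M`.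
    have h : c.idem • f.hom (Subtype.val m) = f.hom (Subtype.val m) := by
      rw [← map_smul]
      exact congrArg _ m.2
    rw [Algebra.algebraMap_eq_smul_one k (A := S), map_smul c.emb, emb_one, Algebra.smul_def,
      mul_smul, h]

theorem isMoritaEquivalent (c : FullCorner K S R) : IsMoritaEquivalent K R S :=
  ⟨⟨{ eqv := c.functor.asEquivalence
      linear := inferInstanceAs (c.functor.Linear K) }⟩⟩

end FullCorner

end FullCorner

/-! ### Trivial extensions: the symmetric form, full corners, isomorphisms. -/

section TrivialExtensionCorner

/-- The trivial extension of a finite-dimensional algebra is symmetric. -/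
theorem isSymmetricKAlgebra_trivialExtension (K : Type u) [Field K] (A : Type u) [Ring A]
    [Algebra K A] [Module.Finite K A] : IsSymmetricKAlgebra K (TrivialExtension K A) := by
  have : Module.Finite K (DualBimodule K A) :=
    inferInstanceAs (Module.Finite K (Module.Dual K A))
  have : Module.Finite K (TrivialExtension K A) :=
    inferInstanceAs (Module.Finite K (A × DualBimodule K A))
  refine ⟨inferInstance, ?_⟩
  -- The pairing of `x` and `y` is the functional component of `x y` evaluated at 1, which is why it
  -- is associative.
  let φ : TrivialExtension K A →ₗ[K] Module.Dual K (TrivialExtension K A) :=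
    LinearMap.mk₂ K (fun x y => x.snd y.fst + y.snd x.fst)
      (fun x y z => by
        simp only [TrivSqZeroExt.snd_add, TrivSqZeroExt.fst_add, DualBimodule.add_apply, map_add]
        ring)
      (fun k x y => by
        simp only [TrivSqZeroExt.snd_smul, TrivSqZeroExt.fst_smul, DualBimodule.base_smul_apply,
          map_smul, smul_eq_mul]
        ring)
      (fun x y z => by
        simp only [TrivSqZeroExt.snd_add, TrivSqZeroExt.fst_add, DualBimodule.add_apply, map_add]
        ring)
      (fun k x y => by
        simp only [TrivSqZeroExt.snd_smul, TrivSqZeroExt.fst_smul, DualBimodule.base_smul_apply,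
          map_smul, smul_eq_mul]
        ring)
  have hφ : ∀ x y, φ x y = x.snd y.fst + y.snd x.fst := fun _ _ => rfl
  have inj : Function.Injective φ := by
    rw [injective_iff_map_eq_zero]
    intro x hx
    have h : ∀ y : TrivialExtension K A, x.snd y.fst + y.snd x.fst = 0 := fun y : TrivialExtension K A => by
      rw [← hφ, hx, LinearMap.zero_apply]
    -- Pairing with functionals detects the component in `A`; pairing with elements of `A` detects
    -- the functional.
    refine TrivSqZeroExt.ext ?_ ?_
    · rw [TrivSqZeroExt.fst_zero, ← Module.forall_dual_apply_eq_zero_iff K]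
      intro f
      have := h (TrivSqZeroExt.inr (show DualBimodule K A from f))
      rw [TrivSqZeroExt.fst_inr, TrivSqZeroExt.snd_inr, map_zero, zero_add] at this
      exact this
    · refine DualBimodule.ext fun a => ?_
      simpa using h (TrivSqZeroExt.inl a)
  let ψ : TrivialExtension K A ≃ₗ[K] Module.Dual K (TrivialExtension K A) :=
    LinearMap.linearEquivOfInjective φ inj Subspace.dual_finrank_eq.symm
  refine ⟨ψ, fun a x b => DualBimodule.ext fun y => ?_⟩
  rw [DualBimodule.smul_apply, DualBimodule.op_smul_apply]
  change φ (a * x * b) y = φ x (b * (y * a))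
  rw [hφ, hφ]
  simp only [TrivSqZeroExt.snd_mul, TrivSqZeroExt.fst_mul, DualBimodule.add_apply, smul_add,
    DualBimodule.smul_apply, DualBimodule.op_smul_apply, MulOpposite.unop_op, mul_assoc]
  ring

namespace FullCorner

variable {K : Type u} [Field K] {S R : Type u} [Ring S] [Algebra K S] [Ring R] [Algebra K R]

/-- The embedding of the trivial extension of a corner. -/
noncomputable def embTrivialExtension (c : FullCorner K S R) :
    TrivialExtension K S →ₗ[K] TrivialExtension K R where
  toFun x := (c.emb x.fst, (LinearMap.comp (show Module.Dual K S from x.snd) c.comp :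
    Module.Dual K R))
  map_add' _ _ := TrivSqZeroExt.ext (map_add c.emb _ _) rfl
  map_smul' _ _ := TrivSqZeroExt.ext (map_smul c.emb _ _) rfl

/-- The compression from the trivial extension to that of a corner. -/
noncomputable def compTrivialExtension (c : FullCorner K S R) :
    TrivialExtension K R →ₗ[K] TrivialExtension K S where
  toFun x := (c.comp x.fst, (LinearMap.comp (show Module.Dual K R from x.snd) c.emb :
    Module.Dual K S))
  map_add' _ _ := TrivSqZeroExt.ext (map_add c.comp _ _) rfl
  map_smul' _ _ := TrivSqZeroExt.ext (map_smul c.comp _ _) rfl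

/-- The idempotent of the corner of `T(R)` is `(e, 0)`. It cuts out `eRe ⊕ e D(R) e`, and `e D(R) e`
consists of the functionals that factor through the compression, that is, of `D(S)`. -/
theorem embTrivialExtension_one (c : FullCorner K S R) :
    c.embTrivialExtension 1 = TrivSqZeroExt.inl c.idem :=
  TrivSqZeroExt.ext rfl (DualBimodule.ext fun _ => rfl)

/-- A full corner of `R` gives a full corner of the trivial extension of `R`. -/
noncomputable def trivialExtension (c : FullCorner K S R) :
    FullCorner K (TrivialExtension K S) (TrivialExtension K R) where
  emb := c.embTrivialExtension
  emb_mul x y := by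
    refine TrivSqZeroExt.ext (c.emb_mul _ _) (DualBimodule.ext fun r => ?_)
    change (x.fst • y.snd + MulOpposite.op y.fst • x.snd) (c.comp r) =
      y.snd (c.comp (r * c.emb x.fst)) + x.snd (c.comp (c.emb y.fst * r))
    rw [c.comp_mul_emb, c.emb_mul_comp]
    rfl
  emb_injective x y h := by
    refine TrivSqZeroExt.ext (c.emb_injective (congrArg TrivSqZeroExt.fst h))
      (DualBimodule.ext fun s => ?_)
    have := congrArg (fun z : TrivialExtension K R => z.snd (c.emb s)) h
    change x.snd (c.comp (c.emb s)) = y.snd (c.comp (c.emb s)) at this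
    rwa [c.comp_emb] at this
  comp := c.compTrivialExtension
  emb_comp x := by
    rw [embTrivialExtension_one]
    refine TrivSqZeroExt.ext ?_ (DualBimodule.ext fun r => ?_)
    · rw [TrivSqZeroExt.fst_mul, TrivSqZeroExt.fst_mul, TrivSqZeroExt.fst_inl]
      exact c.emb_comp _
    · rw [TrivSqZeroExt.snd_mul, TrivSqZeroExt.snd_mul, TrivSqZeroExt.fst_inl,
        TrivSqZeroExt.snd_inl, smul_zero, smul_zero, zero_add, add_zero]
      change x.snd (c.emb (c.comp r)) = x.snd (c.idem * r * c.idem)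
      rw [c.emb_comp, emb_one]
  num := c.num
  left i := TrivSqZeroExt.inl (c.left i)
  right i := TrivSqZeroExt.inl (c.right i)
  sum_eq_one := by
    rw [embTrivialExtension_one]
    have h : ∀ i, (TrivSqZeroExt.inl (c.left i) * TrivSqZeroExt.inl c.idem *
        TrivSqZeroExt.inl (c.right i) : TrivialExtension K R) =
        TrivSqZeroExt.inlAlgHom K R (DualBimodule K R) (c.left i * c.idem * c.right i) := by
      intro i
      rw [map_mul, map_mul]; rfl
    rw [Finset.sum_congr rfl fun i _ => h i, ← map_sum, ← emb_one, c.sum_eq_one, map_one]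

end FullCorner

/-- Isomorphic algebras have isomorphic trivial extensions. -/
noncomputable def TrivialExtension.congr {K : Type u} [Field K] {A B : Type u} [Ring A] [Algebra K A]
    [Ring B] [Algebra K B] (e : A ≃ₐ[K] B) : TrivialExtension K A ≃ₐ[K] TrivialExtension K B :=
  AlgEquiv.ofLinearEquiv
    (LinearEquiv.prodCongr e.toLinearEquiv
      (show DualBimodule K A ≃ₗ[K] DualBimodule K B from e.toLinearEquiv.symm.dualMap) :
      (A × DualBimodule K A) ≃ₗ[K] (B × DualBimodule K B))
    (TrivSqZeroExt.ext (map_one e) (DualBimodule.ext fun x => rfl))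
    (fun x y => by
      refine TrivSqZeroExt.ext (map_mul e _ _) (DualBimodule.ext fun b => ?_)
      change y.snd (e.symm b * x.fst) + x.snd (y.fst * e.symm b) =
        y.snd (e.symm (b * e x.fst)) + x.snd (e.symm (e y.fst * b))
      rw [map_mul e.symm, map_mul e.symm, e.symm_apply_apply, e.symm_apply_apply])

end TrivialExtensionCorner

/-! ### Morita equivalent algebras as full corners of a linking algebra. -/

section MoritaCorner

open CategoryTheory
open scoped ModuleCat.Algebra

/-- If an equivalence of module categories sends `Q` to the regular module, then `Q` is a
generator: the identity of the regular module is a finite sum of maps that factor through `Q`. -/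
theorem ModuleCat.exists_sum_comp_eq_id {A B : Type u} [Ring A] [Ring B]
    (F : ModuleCat.{u} A ⥤ ModuleCat.{u} B) [F.IsEquivalence] [F.Additive] (Q : ModuleCat.{u} A)
    (e : F.obj Q ≅ ModuleCat.of B B) :
    ∃ (n : ℕ) (g : Fin n → (ModuleCat.of A A ⟶ Q)) (f : Fin n → (Q ⟶ ModuleCat.of A A)),
      ∑ i, g i ≫ f i = 𝟙 (ModuleCat.of A A) := by
  -- `J` is the trace of `Q` in the regular module. If it were proper, the projection onto `A ⧸ J`
  -- would be a nonzero map that kills every map from `Q`.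
  let X : Set A := {a | ∃ (f : Q ⟶ ModuleCat.of A A) (q : Q), f.hom q = a}
  let J : Submodule A A := Submodule.span A X
  have hJ : J = ⊤ := by
    let p : ModuleCat.of A A ⟶ ModuleCat.of A (A ⧸ J) := ModuleCat.ofHom J.mkQ
    have hp : ∀ f : Q ⟶ ModuleCat.of A A, f ≫ p = 0 := by
      intro f
      ext q
      exact (Submodule.Quotient.mk_eq_zero J).2 (Submodule.subset_span ⟨f, q, rfl⟩)
    -- Since `F` is full, `F.map p` kills every map from `F.obj Q ≅ B`; such maps reach every
    -- element `x`.
    have hFp : F.map p = 0 := by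
      ext x
      let h : ModuleCat.of B B ⟶ F.obj (ModuleCat.of A A) :=
        ModuleCat.ofHom (LinearMap.toSpanSingleton B _ x)
      have h1 : (e.hom ≫ h) ≫ F.map p = 0 := by
        rw [← F.map_preimage (e.hom ≫ h), ← F.map_comp, hp, F.map_zero]
      have h2 : h ≫ F.map p = 0 := by
        rw [← cancel_epi e.hom, ← Category.assoc, h1, Limits.comp_zero]
      have h3 := LinearMap.congr_fun (ModuleCat.hom_ext_iff.1 h2) (1 : B)
      change (F.map p).hom ((1 : B) • x) = 0 at h3
      rw [one_smul] at h3
      exact h3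
    have hp0 : p = 0 := F.map_injective (by rw [hFp, F.map_zero])
    rw [eq_top_iff]
    intro a _
    exact (Submodule.Quotient.mk_eq_zero J).1
      (LinearMap.congr_fun (ModuleCat.hom_ext_iff.1 hp0) a)
  have h1 : (1 : A) ∈ J := hJ ▸ Submodule.mem_top
  obtain ⟨n, a, x, hx⟩ := Submodule.mem_span_set'.1 h1
  choose f q hq using fun i => (x i).2
  -- From `1 = ∑ aᵢ fᵢ(qᵢ)`: the map `gᵢ` sends 1 to `aᵢ qᵢ`.
  refine ⟨n, fun i => ModuleCat.ofHom (LinearMap.toSpanSingleton A _ (a i • q i)), f, ?_⟩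
  apply ModuleCat.hom_ext
  apply LinearMap.ext_ring
  rw [ModuleCat.hom_sum, LinearMap.sum_apply]
  change ∑ i, (f i).hom ((1 : A) • a i • q i) = 1
  refine Eq.trans (Finset.sum_congr rfl fun i _ => ?_) hx
  rw [one_smul, map_smul, hq]

/-- The opposite of the ring of endomorphisms of `P × B`. -/
abbrev LinkingAlgebra {B : Type u} [Ring B] (P : ModuleCat.{u} B) : Type u :=
  (Module.End B (P × B))ᵐᵒᵖ

variable {K : Type u} [Field K] {A B : Type u} [Ring A] [Algebra K A] [Ring B] [Algebra K B]

/-- The corner of the linking algebra given by the regular module. -/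
theorem nonempty_fullCorner_linkingAlgebra_right (P : ModuleCat.{u} B) (n : ℕ)
    (g : Fin n → (P ⟶ ModuleCat.of B B)) (f : Fin n → (ModuleCat.of B B ⟶ P))
    (h : ∑ i, g i ≫ f i = 𝟙 P) : Nonempty (FullCorner K B (LinkingAlgebra P)) := by
  let emb : B →ₗ[K] LinkingAlgebra P :=
    { toFun b := .op (LinearMap.inr B P B ∘ₗ LinearMap.toSpanSingleton B B b ∘ₗ
        LinearMap.snd B P B)
      map_add' b b' := by
        apply MulOpposite.unop_injective
        ext x <;> simp [mul_add]
      map_smul' k b := by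
        apply MulOpposite.unop_injective
        ext x <;> simp }
  let comp : LinkingAlgebra P →ₗ[K] B :=
    { toFun r := (r.unop (0, 1)).2
      map_add' _ _ := rfl
      map_smul' _ _ := rfl }
  have e1 : (emb 1).unop = LinearMap.inr B P B ∘ₗ LinearMap.snd B P B := by
    ext x <;> simp [emb]
  refine ⟨{
    emb := emb
    emb_mul := fun b b' => by
      apply MulOpposite.unop_injective
      ext x <;> simp [emb]
    emb_injective := fun b b' hb => by
      have := congrArg (fun r : LinkingAlgebra P => (r.unop (0, 1)).2) hb
      simpa [emb] using this
    comp := comp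
    emb_comp := fun r => by
      apply MulOpposite.unop_injective
      rw [MulOpposite.unop_mul, MulOpposite.unop_mul, e1]
      have h0 : r.unop 0 = 0 := map_zero _
      refine LinearMap.prod_ext (LinearMap.ext fun x => ?_) (LinearMap.ext_ring ?_)
      · refine Prod.ext (by simp [emb]) ?_
        have h00 : (r.unop (0, 0)).2 = 0 := congrArg Prod.snd h0
        simp [emb, h00]
      · refine Prod.ext (by simp [emb]) ?_
        simp [emb, comp]
    -- The term of index 0 is the idempotent, the projection onto `B`. The other terms sum to the
    -- projection onto `P` by the factorization `h`; products in the opposite ring are compositions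
    -- in reverse order.
    num := n + 1
    left := Fin.cons 1 fun i => .op (LinearMap.inr B P B ∘ₗ (g i).hom ∘ₗ LinearMap.fst B P B)
    right := Fin.cons 1 fun i => .op (LinearMap.inl B P B ∘ₗ (f i).hom ∘ₗ LinearMap.snd B P B)
    sum_eq_one := ?_ }⟩
  apply MulOpposite.unop_injective
  rw [Fin.sum_univ_succ, MulOpposite.unop_add, Finset.unop_sum]
  have h' : ∀ x : P, ∑ i, (f i).hom ((g i).hom x) = x := by
    intro x
    have := LinearMap.congr_fun (congrArg ModuleCat.Hom.hom h) x
    rw [ModuleCat.hom_sum, LinearMap.sum_apply] at this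
    exact this
  simp only [Fin.cons_zero, Fin.cons_succ, MulOpposite.unop_mul, e1, one_mul, mul_one]
  refine LinearMap.ext fun x => ?_
  rw [LinearMap.add_apply, LinearMap.sum_apply]
  refine Prod.ext ?_ ?_
  · rw [Prod.fst_add, Prod.fst_sum]
    simp [h']
  · rw [Prod.snd_add, Prod.snd_sum]
    simp

/-- The corner of the linking algebra given by the image of the regular module under an
equivalence. -/
theorem nonempty_fullCorner_linkingAlgebra_left (F : ModuleCat.{u} A ⥤ ModuleCat.{u} B)
    [F.IsEquivalence] [F.Additive]
    (hF : ∀ (k : K) (X Y : ModuleCat.{u} A) (f g : X ⟶ Y),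
      (∀ x, g.hom x = algebraMap K A k • f.hom x) →
      ∀ y, (F.map g).hom y = algebraMap K B k • (F.map f).hom y) (n : ℕ)
    (g : Fin n → (ModuleCat.of B B ⟶ F.obj (.of A A)))
    (f : Fin n → (F.obj (.of A A) ⟶ ModuleCat.of B B))
    (h : ∑ i, g i ≫ f i = 𝟙 (ModuleCat.of B B)) :
    Nonempty (FullCorner K A (LinkingAlgebra (F.obj (.of A A)))) := by
  let P := F.obj (.of A A)
  -- Right multiplications identify `A` with the opposite of `End_A(A)`, and hence, `F` being fully
  -- faithful, with the opposite of `End_B(P)`.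
  let ρ (a : A) : ModuleCat.of A A ⟶ ModuleCat.of A A :=
    ModuleCat.ofHom (LinearMap.toSpanSingleton A A a)
  have ρ_mul : ∀ a b, ρ (a * b) = ρ a ≫ ρ b := fun a b => by
    apply ModuleCat.hom_ext; apply LinearMap.ext_ring; simp [ρ]
  have ρ_add : ∀ a b, ρ (a + b) = ρ a + ρ b := fun a b => by
    apply ModuleCat.hom_ext; apply LinearMap.ext_ring; simp [ρ]
  have ρ_smul : ∀ (k : K) a x, (ρ (k • a)).hom x = algebraMap K A k • (ρ a).hom x :=
    fun k a x => by
      change x • k • a = algebraMap K A k • x • a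
      rw [smul_eq_mul, smul_eq_mul, smul_eq_mul, ← Algebra.smul_def, mul_smul_comm]
  have ρ_one : ρ 1 = 𝟙 _ := by
    apply ModuleCat.hom_ext; apply LinearMap.ext_ring; simp [ρ]
  have ρ_eval : ∀ f : ModuleCat.of A A ⟶ ModuleCat.of A A, ρ (f.hom (1 : A)) = f := fun f => by
    apply ModuleCat.hom_ext; apply LinearMap.ext_ring; simp [ρ]
  have ρ_inj : ∀ a b, ρ a = ρ b → a = b := fun a b hab => by
    have := LinearMap.congr_fun (ModuleCat.hom_ext_iff.1 hab) (1 : A)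
    simpa [ρ] using this
  let emb : A →ₗ[K] LinkingAlgebra P :=
    { toFun a := .op (LinearMap.inl B P B ∘ₗ (F.map (ρ a)).hom ∘ₗ LinearMap.fst B P B)
      map_add' b b' := by
        apply MulOpposite.unop_injective
        rw [ρ_add, F.map_add]
        ext x <;> simp
      map_smul' k b := by
        apply MulOpposite.unop_injective
        refine LinearMap.prod_ext (LinearMap.ext fun x => ?_) (LinearMap.ext_ring ?_)
        · exact Prod.ext (hF k _ _ _ _ (ρ_smul k b) x) (smul_zero k).symm
        · refine Prod.ext ?_ (smul_zero k).symm
          change (F.map (ρ (k • b))).hom 0 = algebraMap K B k • (F.map (ρ b)).hom 0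
          rw [map_zero, map_zero, smul_zero] }
  let corner (r : LinkingAlgebra P) : P ⟶ P :=
    ModuleCat.ofHom (LinearMap.fst B P B ∘ₗ r.unop ∘ₗ LinearMap.inl B P B)
  let comp : LinkingAlgebra P →ₗ[K] A :=
    { toFun r := (F.preimage (corner r)).hom (1 : A)
      map_add' r t := by
        rw [show corner (r + t) = corner r + corner t from rfl,
          show F.preimage (corner r + corner t) = F.preimage (corner r) + F.preimage (corner t) from
            F.map_injective (by simp)]
        rfl
      map_smul' k r := by
        apply ρ_inj
        apply F.map_injective
        rw [ρ_eval, F.map_preimage]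
        ext x
        refine Eq.symm ((hF k _ _ (F.preimage (corner r)) _ (fun y => ?_) x).trans ?_)
        · rw [ρ_smul, ρ_eval]
          rfl
        · rw [F.map_preimage]
          rfl }
  have e1 : (emb 1).unop = LinearMap.inl B P B ∘ₗ LinearMap.fst B P B := by
    ext x <;> simp [emb, ρ_one, P]
  refine ⟨{
    emb := emb
    emb_mul := fun b b' => by
      apply MulOpposite.unop_injective
      ext x <;> simp [emb, ρ_mul]
    emb_injective := fun b b' hb => by
      apply ρ_inj
      apply F.map_injective
      ext x
      have := congrArg (fun r : LinkingAlgebra P => (r.unop (x, 0)).1) hb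
      simpa [emb] using this
    comp := comp
    emb_comp := fun r => by
      apply MulOpposite.unop_injective
      rw [MulOpposite.unop_mul, MulOpposite.unop_mul, e1]
      have h0 : r.unop 0 = 0 := map_zero _
      refine LinearMap.prod_ext (LinearMap.ext fun x => ?_) (LinearMap.ext_ring ?_)
      · refine Prod.ext ?_ (by simp [emb])
        simp [emb, comp, ρ_eval, corner]
        rfl
      · refine Prod.ext ?_ (by simp [emb])
        have h00 : (r.unop (0, 0)).1 = 0 := congrArg Prod.fst h0
        simp [emb, h00]
    num := n + 1
    left := Fin.cons 1 fun i => .op (LinearMap.inl B P B ∘ₗ (g i).hom ∘ₗ LinearMap.snd B P B)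
    right := Fin.cons 1 fun i => .op (LinearMap.inr B P B ∘ₗ (f i).hom ∘ₗ LinearMap.fst B P B)
    sum_eq_one := ?_ }⟩
  apply MulOpposite.unop_injective
  rw [Fin.sum_univ_succ, MulOpposite.unop_add, Finset.unop_sum]
  have h' : ∀ x : B, ∑ i, (f i).hom ((g i).hom x) = x := by
    intro x
    have := LinearMap.congr_fun (congrArg ModuleCat.Hom.hom h) x
    rw [ModuleCat.hom_sum, LinearMap.sum_apply] at this
    exact this
  simp only [Fin.cons_zero, Fin.cons_succ, MulOpposite.unop_mul, e1, one_mul, mul_one]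
  refine LinearMap.ext fun x => ?_
  rw [LinearMap.add_apply, LinearMap.sum_apply]
  refine Prod.ext ?_ ?_
  · rw [Prod.fst_add, Prod.fst_sum]
    simp
  · rw [Prod.snd_add, Prod.snd_sum]
    simp [h']

/-- Morita equivalent algebras are full corners of a common algebra. -/
theorem IsMoritaEquivalent.exists_fullCorner (h : IsMoritaEquivalent K A B) :
    ∃ (L : Type u) (_ : Ring L) (_ : Algebra K L),
      Nonempty (FullCorner K A L) ∧ Nonempty (FullCorner K B L) := by
  obtain ⟨⟨e⟩⟩ := h
  let F := e.eqv.functor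
  have : e.eqv.inverse.Additive := e.symm.eqv.functor.additive_of_preserves_binary_products
  let Q := e.eqv.inverse.obj (ModuleCat.of B B)
  -- The modules `F(A)` and `B` generate each other: applied to `F` this factors the identity of
  -- `F(A)` through `B`, and applied to the inverse it factors the identity of `B` through `F(A)`.
  -- These are the two fullness conditions.
  obtain ⟨n, g, f, h1⟩ := ModuleCat.exists_sum_comp_eq_id F Q (e.eqv.counitIso.app _)
  obtain ⟨m, g', f', h2⟩ := ModuleCat.exists_sum_comp_eq_id e.eqv.inverse (F.obj (.of A A))
    (e.eqv.unitIso.symm.app _)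
  refine ⟨LinkingAlgebra (F.obj (.of A A)), inferInstance, inferInstance,
    nonempty_fullCorner_linkingAlgebra_left F (fun k X Y f g hfg y => ?_) m g' f' h2,
    nonempty_fullCorner_linkingAlgebra_right _ n
      (fun i => F.map (g i) ≫ (e.eqv.counitIso.app _).hom)
      (fun i => (e.eqv.counitIso.app _).inv ≫ F.map (f i)) ?_⟩
  · have h3 : g = k • f := by
      apply ModuleCat.hom_ext
      exact LinearMap.ext hfg
    rw [h3, e.linear.map_smul]
    rfl
  have h3 := congrArg F.map h1
  rw [F.map_sum, F.map_id] at h3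
  rw [← h3]
  refine Finset.sum_congr rfl fun i _ => ?_
  simp

/-- Trivial extensions of Morita equivalent algebras are Morita equivalent. -/
theorem IsMoritaEquivalent.trivialExtension (h : IsMoritaEquivalent K A B) :
    IsMoritaEquivalent K (TrivialExtension K A) (TrivialExtension K B) := by
  obtain ⟨L, _, _, ⟨c⟩, ⟨d⟩⟩ := h.exists_fullCorner
  exact IsMoritaEquivalent.trans K (c.trivialExtension.isMoritaEquivalent.symm K)
    d.trivialExtension.isMoritaEquivalent

end MoritaCorner

/-! # Path algebras: linear maps, the universal property, monomial ideals -/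

namespace PathAlgebra

variable {K : Type u} [Field K] {V : Type u} [Quiver.{u} V]

section Linear

variable [Fintype V]

theorem eq_sum_sum_single (x : PathAlgebra K V) :
    x = ∑ a, ∑ b, (x a b).sum fun p k => k • ofPath p := by
  classical
  have h : ∀ a b, ((x a b).sum fun p k => k • (ofPath p : PathAlgebra K V)) =
      (Pi.single a (Pi.single b (x a b)) : ∀ a b : V, Quiver.Path a b →₀ K) := by
    intro a b
    have h1 : ∀ f : Quiver.Path a b →₀ K, (f.sum fun p k => k • (ofPath p : PathAlgebra K V)) =
        (Pi.single a (Pi.single b f) : ∀ a b : V, Quiver.Path a b →₀ K) := by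
      intro f
      induction f using Finsupp.induction_linear with
      | zero => simp; rfl
      | add f g hf hg =>
        rw [Finsupp.sum_add_index' (by simp) (by simp [add_smul]), hf, hg, Pi.single_add,
          Pi.single_add]
        rfl
      | single p k =>
        rw [Finsupp.sum_single_index (by simp)]
        change k • (Pi.single a (Pi.single b (Finsupp.single p 1)) :
          ∀ a b : V, Quiver.Path a b →₀ K) = _
        rw [← Pi.single_smul, ← Pi.single_smul, Finsupp.smul_single, smul_eq_mul, mul_one]
    exact h1 _
  simp only [h]
  funext a b
  change _ = (∑ a, ∑ b, (Pi.single a (Pi.single b (x a b)) : ∀ a b : V, Quiver.Path a b →₀ K)) a b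
  simp only [Finset.sum_apply]
  rw [Finset.sum_eq_single a, Finset.sum_eq_single b]
  · simp
  · intro c _ hc; simp [hc.symm]
  · simp
  · intro c _ hc; simp [hc.symm]
  · simp

/-- Induction along the basis of paths. -/
theorem induction_on {P : PathAlgebra K V → Prop} (x : PathAlgebra K V) (zero : P 0)
    (add : ∀ x y, P x → P y → P (x + y))
    (smul : ∀ (k : K) (a b : V) (p : Quiver.Path a b), P (k • ofPath p)) : P x := by
  rw [eq_sum_sum_single x]
  refine Finset.sum_induction _ P add zero fun a _ => ?_
  refine Finset.sum_induction _ P add zero fun b _ => ?_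
  exact Finset.sum_induction _ P add zero fun p _ => smul _ _ _ p

variable {M : Type*} [AddCommGroup M] [Module K M]

/-- The linear map with given values on paths. -/
noncomputable def lin (φ : ∀ a b : V, Quiver.Path a b → M) : PathAlgebra K V →ₗ[K] M where
  toFun x := ∑ a, ∑ b, Finsupp.linearCombination K (φ a b) (x a b)
  map_add' x y := by simp [add_apply, Finset.sum_add_distrib]
  map_smul' k x := by simp [smul_apply, Finset.smul_sum]

theorem lin_apply (φ : ∀ a b : V, Quiver.Path a b → M) (x : PathAlgebra K V) :
    lin φ x = ∑ a, ∑ b, Finsupp.linearCombination K (φ a b) (x a b) := rfl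

theorem lin_ofPath (φ : ∀ a b : V, Quiver.Path a b → M) {a b : V} (p : Quiver.Path a b) :
    lin φ (ofPath p : PathAlgebra K V) = φ a b p := by
  classical
  rw [lin_apply, Finset.sum_eq_single a, Finset.sum_eq_single b]
  · simp [ofPath]
  · intro c _ hc; simp [ofPath, hc]
  · simp
  · intro c _ hc; simp [ofPath, hc]
  · simp

theorem linearMap_ext {f g : PathAlgebra K V →ₗ[K] M}
    (h : ∀ (a b : V) (p : Quiver.Path a b), f (ofPath p) = g (ofPath p)) : f = g := by
  refine LinearMap.ext fun x => ?_
  induction x using induction_on with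
  | zero => simp
  | add x y hx hy => rw [map_add, map_add, hx, hy]
  | smul k a b p => rw [map_smul, map_smul, h]

theorem one_eq_sum : (1 : PathAlgebra K V) = ∑ a, ofPath (Quiver.Path.nil : Quiver.Path a a) := by
  classical
  funext b c
  have h : (∑ a, (ofPath (Quiver.Path.nil : Quiver.Path a a) : PathAlgebra K V)) b c =
      ∑ a, (ofPath (Quiver.Path.nil : Quiver.Path a a) : PathAlgebra K V) b c := by
    let ev : PathAlgebra K V →+ (Quiver.Path b c →₀ K) := ⟨⟨fun x => x b c, rfl⟩, fun _ _ => rfl⟩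
    exact map_sum ev _ _
  rw [h, Finset.sum_eq_single b]
  · simp [one_apply, ofPath]
  · intro a _ ha; simp [ofPath, ha.symm]
  · simp

end Linear

section Lift

variable {R : Type*} [Ring R] [Algebra K R]

/-- The image of a path under a representation of the quiver in an algebra. -/
def evalPath (e : V → R) (θ : ∀ a b : V, (a ⟶ b) → R) (a : V) : ∀ b : V, Quiver.Path a b → R
  | _, .nil => e a
  | _, .cons p x => evalPath e θ a _ p * θ _ _ x

variable (e : V → R) (θ : ∀ a b : V, (a ⟶ b) → R)

theorem evalPath_mul_idem (he : ∀ a, e a * e a = e a)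
    (hr : ∀ a b (x : a ⟶ b), θ a b x * e b = θ a b x) {a b : V} (p : Quiver.Path a b) :
    evalPath e θ a b p * e b = evalPath e θ a b p := by
  cases p with
  | nil => exact he a
  | cons p x => rw [evalPath, mul_assoc, hr]

theorem idem_mul_evalPath (he : ∀ a, e a * e a = e a) {a b : V} (p : Quiver.Path a b) :
    e a * evalPath e θ a b p = evalPath e θ a b p := by
  induction p with
  | nil => exact he a
  | cons p x ih => rw [evalPath, ← mul_assoc, ih]

theorem evalPath_comp (he : ∀ a, e a * e a = e a)
    (hr : ∀ a b (x : a ⟶ b), θ a b x * e b = θ a b x) {a b c : V} (p : Quiver.Path a b)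
    (q : Quiver.Path b c) :
    evalPath e θ a c (p.comp q) = evalPath e θ a b p * evalPath e θ b c q := by
  induction q with
  | nil => exact (evalPath_mul_idem e θ he hr p).symm
  | cons q x ih => rw [Quiver.Path.comp_cons, evalPath, ih, mul_assoc]; rfl

variable [Fintype V]

/-- The universal property of the path algebra. -/
noncomputable def liftAlg (he : ∀ a, e a * e a = e a) (hne : ∀ a b, a ≠ b → e a * e b = 0)
    (hsum : ∑ a, e a = 1) (hr : ∀ a b (x : a ⟶ b), θ a b x * e b = θ a b x) : PathAlgebra K V →ₐ[K] R :=
  AlgHom.ofLinearMap (lin (evalPath e θ))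
    (by
      rw [one_eq_sum, map_sum, ← hsum]
      exact Finset.sum_congr rfl fun a _ => lin_ofPath _ _)
    (fun x y => by
      induction x using induction_on with
      | zero => simp
      | add x x' hx hx' => rw [add_mul, map_add, map_add, hx, hx', add_mul]
      | smul k a b p =>
        induction y using induction_on with
        | zero => simp
        | add x x' hx hx' => rw [mul_add, map_add, map_add, hx, hx', mul_add]
        | smul l c d q =>
          rw [smul_mul_assoc, mul_smul_comm, map_smul, map_smul, map_smul, map_smul,
            smul_mul_assoc, mul_smul_comm]
          congr 2
          by_cases h : b = c
          · subst h
            rw [ofPath_mul_ofPath, lin_ofPath, lin_ofPath, lin_ofPath, evalPath_comp e θ he hr]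
          · rw [ofPath_mul_ofPath_of_ne _ _ h, map_zero, lin_ofPath, lin_ofPath,
              ← evalPath_mul_idem e θ he hr p, ← idem_mul_evalPath e θ he q, mul_assoc,
              ← mul_assoc (e b), hne _ _ h, zero_mul, mul_zero])

section

variable (he : ∀ a, e a * e a = e a) (hne : ∀ a b, a ≠ b → e a * e b = 0)
    (hsum : ∑ a, e a = 1) (hr : ∀ a b (x : a ⟶ b), θ a b x * e b = θ a b x)

theorem liftAlg_ofPath {a b : V} (p : Quiver.Path a b) :
    liftAlg (K := K) e θ he hne hsum hr (ofPath p) = evalPath e θ a b p := lin_ofPath _ _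

/-- A path is evaluated starting from the idempotent of its source, so an arrow has the value `e a *
θ a b x`; `hl` removes the idempotent. -/
theorem liftAlg_ofArrow {a b : V} (x : a ⟶ b) (hl : e a * θ a b x = θ a b x) :
    liftAlg (K := K) e θ he hne hsum hr (ofArrow x) = θ a b x :=
  (lin_ofPath _ _).trans hl

end

end Lift

section Idempotents

variable [Fintype V]

variable (K) in
/-- The idempotent of a vertex. -/
noncomputable def vertexIdem (a : V) : PathAlgebra K V := ofPath (Quiver.Path.nil : Quiver.Path a a)

theorem vertexIdem_mul_ofPath {a b : V} (p : Quiver.Path a b) :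
    vertexIdem K a * ofPath p = ofPath p := by
  rw [vertexIdem, ofPath_mul_ofPath, Quiver.Path.nil_comp]

theorem ofPath_mul_vertexIdem {a b : V} (p : Quiver.Path a b) :
    ofPath p * vertexIdem K b = ofPath p := by
  rw [vertexIdem, ofPath_mul_ofPath, Quiver.Path.comp_nil]

theorem ofPath_cons {a b c : V} (p : Quiver.Path a b) (x : b ⟶ c) :
    (ofPath (p.cons x) : PathAlgebra K V) = ofPath p * ofArrow x := by
  rw [ofArrow, ofPath_mul_ofPath]; rfl

end Idempotents

/-! ## The arrows of a path -/

variable (V) in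
/-- The type of all arrows of a quiver. -/
abbrev Arr : Type u := Σ a b : V, (a ⟶ b)

/-- The list of arrows of a path. -/
def arrows {a : V} : ∀ {b : V}, Quiver.Path a b → List (Arr V)
  | _, .nil => []
  | _, .cons p x => arrows p ++ [⟨_, _, x⟩]

theorem arrows_nil {a : V} : arrows (Quiver.Path.nil : Quiver.Path a a) = [] := rfl

theorem arrows_cons {a b c : V} (p : Quiver.Path a b) (x : b ⟶ c) :
    arrows (p.cons x) = arrows p ++ [⟨b, c, x⟩] := rfl

theorem arrows_comp {a b c : V} (p : Quiver.Path a b) (q : Quiver.Path b c) :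
    arrows (p.comp q) = arrows p ++ arrows q := by
  induction q with
  | nil => simp [arrows]
  | cons q x ih => simp [arrows_cons, ih]

theorem length_arrows {a b : V} (p : Quiver.Path a b) : (arrows p).length = p.length := by
  induction p with
  | nil => rfl
  | cons p x ih => simp [arrows_cons, ih]

theorem arrows_injective {a b : V} (p q : Quiver.Path a b) (h : arrows p = arrows q) : p = q := by
  induction p with
  | nil =>
    cases q with
    | nil => rfl
    | cons q y => simp [arrows] at h
  | cons p x ih =>
    cases q with
    | nil => simp [arrows] at h
    | cons q y =>
      rw [arrows_cons, arrows_cons] at h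
      obtain ⟨h1, h2⟩ := List.append_inj' h rfl
      rw [List.singleton_inj] at h2
      cases h2
      rw [ih q h1]

/-! ### Quadratic monomial ideals and the paths outside of them. -/

section Monomial

theorem ofPath_apply_self {a b : V} (p : Quiver.Path a b) :
    (ofPath p : PathAlgebra K V) a b p = 1 := by
  simp [ofPath]

theorem eq_of_ofPath_apply_ne_zero {a b c d : V} {p : Quiver.Path a b} {q : Quiver.Path c d}
    (h : (ofPath p : PathAlgebra K V) c d q ≠ 0) :
    (⟨a, b, p⟩ : Σ a b : V, Quiver.Path a b) = ⟨c, d, q⟩ := by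
  classical
  by_cases hc : c = a
  · subst hc
    by_cases hd : d = b
    · subst hd
      by_cases hq : q = p
      · rw [hq]
      · simp [ofPath, Finsupp.single_eq_of_ne hq] at h
    · simp [ofPath, hd] at h
  · simp [ofPath, hc] at h

variable [Fintype V]

/-- The coefficient of `q` in a product is a sum over the factorizations of `q`. -/
theorem exists_of_mul_apply_ne_zero {x y : PathAlgebra K V} {a c : V} {q : Quiver.Path a c}
    (h : (x * y) a c q ≠ 0) : ∃ (b : V) (p : Quiver.Path a b) (r : Quiver.Path b c),
      q = p.comp r ∧ x a b p ≠ 0 ∧ y b c r ≠ 0 := by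
  rw [mul_apply, Finsupp.finsetSum_apply] at h
  obtain ⟨b, -, hb⟩ := Finset.exists_ne_zero_of_sum_ne_zero h
  refine ⟨b, ?_⟩
  simp only [concat, Finsupp.lift_apply, Finsupp.sum, LinearMap.coe_sum, Finset.sum_apply,
    Finsupp.finsetSum_apply, LinearMap.smul_apply, Finsupp.smul_apply, Finsupp.lmapDomain_apply,
    Finsupp.mapDomain] at hb
  obtain ⟨p, hp, hp'⟩ := Finset.exists_ne_zero_of_sum_ne_zero hb
  rw [smul_eq_mul] at hp'
  obtain ⟨r, hr, hr'⟩ := Finset.exists_ne_zero_of_sum_ne_zero (right_ne_zero_of_mul hp')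
  refine ⟨p, r, ?_, Finsupp.mem_support_iff.1 hp, Finsupp.mem_support_iff.1 hr⟩
  by_contra hne
  exact hr' (Finsupp.single_eq_of_ne hne)

/-- The ideal of all elements that vanish on the paths in a set that is closed under subpaths. -/
noncomputable def vanishingIdeal (P : ∀ {a b : V}, Quiver.Path a b → Prop)
    (hP : ∀ {a b c : V} (p : Quiver.Path a b) (q : Quiver.Path b c), P (p.comp q) → P p ∧ P q) :
    TwoSidedIdeal (PathAlgebra K V) :=
  TwoSidedIdeal.mk' {x | ∀ (a b : V) (q : Quiver.Path a b), P q → x a b q = 0}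
    (fun _ _ _ _ => rfl)
    (fun {x y} hx hy a b q hq => by
      rw [add_apply, Finsupp.add_apply, hx a b q hq, hy a b q hq, add_zero])
    (fun {x} hx a b q hq => by
      change -(x a b q) = 0
      rw [hx a b q hq, neg_zero])
    (fun {x y} hy a b q hq => by
      by_contra h
      obtain ⟨c, p, r, rfl, -, hr⟩ := exists_of_mul_apply_ne_zero h
      exact hr (hy _ _ r (hP p r hq).2))
    (fun {x y} hx a b q hq => by
      by_contra h
      obtain ⟨c, p, r, rfl, hp, -⟩ := exists_of_mul_apply_ne_zero h
      exact hp (hx _ _ p (hP p r hq).1))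

theorem mem_vanishingIdeal {P : ∀ {a b : V}, Quiver.Path a b → Prop}
    {hP : ∀ {a b c : V} (p : Quiver.Path a b) (q : Quiver.Path b c), P (p.comp q) → P p ∧ P q}
    {x : PathAlgebra K V} :
    x ∈ vanishingIdeal P hP ↔ ∀ (a b : V) (q : Quiver.Path a b), P q → x a b q = 0 :=
  TwoSidedIdeal.mem_mk' _ _ _ _ _ _ _

/-- Two arrows have a product outside of the ideal. -/
def Follows (I : TwoSidedIdeal (PathAlgebra K V)) (a b : Arr V) : Prop :=
  ofArrow a.2.2 * ofArrow b.2.2 ∉ I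

theorem Follows.tgt_eq {I : TwoSidedIdeal (PathAlgebra K V)} {a b : Arr V} (h : Follows I a b) :
    a.2.1 = b.1 := by
  by_contra hne
  apply h
  rw [ofArrow, ofArrow, ofPath_mul_ofPath_of_ne _ _ hne]
  exact I.zero_mem

/-- A failing link is a subpath of length two in `I`, and `I` absorbs the rest of the path. -/
theorem ofPath_mem_of_not_isChain (I : TwoSidedIdeal (PathAlgebra K V)) {a b : V}
    (p : Quiver.Path a b) (h : ¬ (arrows p).IsChain (Follows I)) : ofPath p ∈ I := by
  induction p with
  | nil => exact absurd List.isChain_nil h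
  | cons p x ih =>
    by_cases hp : (arrows p).IsChain (Follows I)
    · cases p with
      | nil => exact absurd (List.isChain_singleton _) h
      | cons p y =>
        rw [arrows_cons, List.isChain_append] at h
        have h1 : ofArrow y * ofArrow x ∈ I := by
          by_contra hyx
          refine h ⟨hp, List.isChain_singleton _, ?_⟩
          intro z hz w hw
          rw [arrows_cons, List.getLast?_append_of_ne_nil _ (by simp)] at hz
          simp only [List.getLast?_singleton, Option.mem_def, Option.some.injEq,
            List.head?_cons] at hz hw
          subst hz hw
          exact hyx
        rw [ofPath_cons, ofPath_cons, mul_assoc]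
        exact I.mul_mem_left _ _ h1
    · rw [ofPath_cons]
      exact I.mul_mem_right _ _ (ih hp)

/-- A quadratic monomial ideal consists of the elements that vanish on the paths all of whose
subpaths of length two lie outside of the ideal. -/
theorem mem_iff_of_isQuadraticMonomialIdeal {I : TwoSidedIdeal (PathAlgebra K V)}
    (hI : IsQuadraticMonomialIdeal I) (x : PathAlgebra K V) :
    x ∈ I ↔ ∀ (a b : V) (q : Quiver.Path a b), (arrows q).IsChain (Follows I) → x a b q = 0 := by
  constructor
  · obtain ⟨S, hS, hIS⟩ := hI
    have hP : ∀ {a b c : V} (p : Quiver.Path a b) (q : Quiver.Path b c),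
        (arrows (p.comp q)).IsChain (Follows I) →
        (arrows p).IsChain (Follows I) ∧ (arrows q).IsChain (Follows I) := by
      intro a b c p q h
      rw [arrows_comp, List.isChain_append] at h
      exact ⟨h.1, h.2.1⟩
    -- A generator has a nonzero coefficient only at itself, and being a product of two arrows in
    -- `I` it is not a chain.
    have h : I ≤ vanishingIdeal (fun {a b} q => (arrows q).IsChain (Follows I)) hP := by
      conv_lhs => rw [hIS]
      rw [TwoSidedIdeal.span_le]
      intro s hs
      have hsI : s ∈ I := by rw [hIS]; exact TwoSidedIdeal.subset_span hs
      obtain ⟨a, b, p, hp, rfl⟩ := hS s hs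
      refine mem_vanishingIdeal.2 fun c d q hq => ?_
      by_contra hne
      cases eq_of_ofPath_apply_ne_zero hne
      cases p with
      | nil => simp at hp
      | cons p y =>
        cases p with
        | nil => simp at hp
        | cons p z =>
          cases p with
          | cons p w => simp at hp
          | nil =>
            simp only [arrows_cons, arrows_nil, List.nil_append, List.cons_append,
              List.isChain_cons_cons] at hq
            apply hq.1
            rw [ofPath_cons] at hsI
            exact hsI
    exact fun hx => mem_vanishingIdeal.1 (h hx)
  · intro h
    rw [eq_sum_sum_single x]
    refine Finset.sum_induction _ (· ∈ I) (fun _ _ => I.add_mem) I.zero_mem fun a _ => ?_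
    refine Finset.sum_induction _ (· ∈ I) (fun _ _ => I.add_mem) I.zero_mem fun b _ => ?_
    refine Finset.sum_induction _ (· ∈ I) (fun _ _ => I.add_mem) I.zero_mem fun p _ => ?_
    change (x a b p) • ofPath p ∈ I
    by_cases hp : (arrows p).IsChain (Follows I)
    · rw [h a b p hp, zero_smul]
      exact I.zero_mem
    · rw [Algebra.smul_def]
      exact I.mul_mem_left _ _ (ofPath_mem_of_not_isChain I p hp)

theorem ofPath_notMem_of_isChain {I : TwoSidedIdeal (PathAlgebra K V)}
    (hI : IsQuadraticMonomialIdeal I) {a b : V} (p : Quiver.Path a b)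
    (hp : (arrows p).IsChain (Follows I)) : ofPath p ∉ I := fun h => by
  have := (mem_iff_of_isQuadraticMonomialIdeal hI _).1 h a b p hp
  rw [ofPath_apply_self] at this
  exact one_ne_zero this

end Monomial

end PathAlgebra

/-! # Quivers whose arrows are arranged in cycles -/

open PathAlgebra

theorem QuiverAlgebra.mk_eq_zero_iff {K : Type u} [Field K] {V : Type u} [Quiver.{u} V] [Fintype V]
    (I : TwoSidedIdeal (PathAlgebra K V)) (x : PathAlgebra K V) :
    I.ringCon.mkₐ K x = 0 ↔ x ∈ I := by
  rw [TwoSidedIdeal.mem_iff, ← RingCon.eq]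
  rfl

/-- A quiver whose arrows are indexed by a type with a permutation, such that the target of an arrow
is the source of the next one. -/
structure CyclicQuiver (W : Type u) [Quiver.{u} W] (E : Type u) where
  /-- the next arrow -/
  next : E → E
  /-- the length of the cycle of an arrow -/
  len : E → ℕ
  /-- the source of an arrow -/
  src : E → W
  /-- the arrow with a given index -/
  hom : ∀ x, src x ⟶ src (next x)
  hom_bijective : Function.Bijective fun x => (⟨src x, src (next x), hom x⟩ : Arr W)
  len_pos : ∀ x, 0 < len x
  len_next : ∀ x, len (next x) = len x
  iterate_len : ∀ x, next^[len x] x = x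
  src_surjective : Function.Surjective src

namespace CyclicQuiver

variable {W : Type u} [Quiver.{u} W] {E : Type u} (c : CyclicQuiver W E)

theorem len_iterate (x : E) (k : ℕ) : c.len (c.next^[k] x) = c.len x := by
  induction k with
  | zero => rfl
  | succ k ih => rw [Function.iterate_succ_apply', c.len_next, ih]

/-- Elements with equal successors have the same `len`, and `len - 1` further applications of `next`
lead back to each of them. -/
theorem next_injective : Function.Injective c.next := by
  intro x y h
  have hl : c.len x = c.len y := by rw [← c.len_next x, h, c.len_next]
  rw [← c.iterate_len x, ← c.iterate_len y, hl]
  obtain ⟨n, hn⟩ := Nat.exists_eq_succ_of_ne_zero (c.len_pos y).ne'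
  rw [hn, Function.iterate_succ_apply, Function.iterate_succ_apply, h]

theorem finite_hom {W : Type u} [Quiver.{u} W] {E : Type u} (c : CyclicQuiver W E) [Finite E]
    (a b : W) : Finite (a ⟶ b) := by
  have : Finite (Arr W) := Finite.of_surjective _ c.hom_bijective.2
  refine Finite.of_injective (fun x : a ⟶ b => (⟨a, b, x⟩ : Arr W)) fun x y h => ?_
  cases h
  rfl

section Products

variable {R : Type*} [Ring R] (f : E → R)

/-- The product of the values of `f` along `k` consecutive arrows. -/
def cyc (x : E) (k : ℕ) : R := ((List.range k).map fun i => f (c.next^[i] x)).prod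

theorem cyc_zero (x : E) : c.cyc f x 0 = 1 := rfl

theorem cyc_succ (x : E) (k : ℕ) : c.cyc f x (k + 1) = c.cyc f x k * f (c.next^[k] x) := by
  simp [cyc, List.range_succ]

theorem cyc_one (x : E) : c.cyc f x 1 = f x := by
  simp [cyc]

theorem cyc_succ' (x : E) (k : ℕ) : c.cyc f x (k + 1) = f x * c.cyc f (c.next x) k := by
  simp only [cyc, List.range_succ_eq_map, List.map_cons, List.prod_cons, List.map_map]
  rfl

theorem cyc_add (x : E) (k l : ℕ) :
    c.cyc f x (k + l) = c.cyc f x k * c.cyc f (c.next^[k] x) l := by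
  induction l with
  | zero => simp [cyc_zero]
  | succ l ih =>
    rw [← add_assoc, cyc_succ, ih, cyc_succ, mul_assoc, ← Function.iterate_add_apply, add_comm l k]

theorem map_cyc {S : Type*} [Ring S] (g : R →+* S) (x : E) (k : ℕ) :
    g (c.cyc f x k) = c.cyc (fun y => g (f y)) x k := by
  simp [cyc, map_list_prod, Function.comp_def]

variable {f}

theorem cyc_mul_of_ne (h3 : ∀ x y, y ≠ c.next x → f x * f y = 0) {x y : E} {k : ℕ} (hk : 0 < k)
    (hy : y ≠ c.next^[k] x) : c.cyc f x k * f y = 0 := by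
  obtain ⟨k, rfl⟩ := Nat.exists_eq_succ_of_ne_zero hk.ne'
  rw [Function.iterate_succ_apply'] at hy
  rw [cyc_succ, mul_assoc, h3 _ _ hy, mul_zero]

theorem cyc_mul_cyc_of_ne (h3 : ∀ x y, y ≠ c.next x → f x * f y = 0) {x y : E} {k l : ℕ}
    (hk : 0 < k) (hl : 0 < l) (hy : y ≠ c.next^[k] x) : c.cyc f x k * c.cyc f y l = 0 := by
  obtain ⟨l, rfl⟩ := Nat.exists_eq_succ_of_ne_zero hl.ne'
  rw [cyc_succ', ← mul_assoc, c.cyc_mul_of_ne h3 hk hy, zero_mul]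

theorem cyc_eq_zero (h2 : ∀ x, c.cyc f x (c.len x) * f x = 0) {x : E} {k : ℕ} (hk : c.len x < k) :
    c.cyc f x k = 0 := by
  obtain ⟨l, rfl⟩ := Nat.exists_eq_add_of_lt hk
  rw [add_assoc, cyc_add, c.iterate_len, cyc_succ', ← mul_assoc, h2, zero_mul]

end Products

section Algebra

variable [Fintype W] (K : Type u) [Field K]

/-- An arrow as an element of the path algebra. -/
noncomputable def arrowElt (x : E) : PathAlgebra K W := ofArrow (c.hom x)

/-- The relations that identify the cycles at a vertex. -/
def relationsOne : Set (PathAlgebra K W) :=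
  {r | ∃ x y : E, c.src x = c.src y ∧
    r = c.cyc (c.arrowElt K) x (c.len x) - c.cyc (c.arrowElt K) y (c.len y)}

/-- The relations that kill the paths that are longer than their cycle. -/
def relationsTwo : Set (PathAlgebra K W) :=
  {r | ∃ x : E, r = c.cyc (c.arrowElt K) x (c.len x) * c.arrowElt K x}

/-- The relations that kill the products of arrows that do not follow each other. -/
def relationsThree : Set (PathAlgebra K W) :=
  {r | ∃ x y : E, y ≠ c.next x ∧ r = c.arrowElt K x * c.arrowElt K y}

/-- The ideal of all relations. -/
noncomputable def ideal : TwoSidedIdeal (PathAlgebra K W) :=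
  TwoSidedIdeal.span (c.relationsOne K ∪ c.relationsTwo K ∪ c.relationsThree K)

/-- The class of an arrow modulo the relations. -/
noncomputable def arrowClass (x : E) : QuiverAlgebra (c.ideal K) :=
  (c.ideal K).ringCon.mkₐ K (c.arrowElt K x)

theorem mk_cyc (x : E) (k : ℕ) :
    (c.ideal K).ringCon.mkₐ K (c.cyc (c.arrowElt K) x k) = c.cyc (c.arrowClass K) x k :=
  c.map_cyc _ ((c.ideal K).ringCon.mkₐ K).toRingHom x k

theorem arrowClass_mul_of_ne (x y : E) (h : y ≠ c.next x) :
    c.arrowClass K x * c.arrowClass K y = 0 := by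
  rw [arrowClass, arrowClass, ← map_mul, QuiverAlgebra.mk_eq_zero_iff]
  exact TwoSidedIdeal.subset_span (Or.inr ⟨x, y, h, rfl⟩)

theorem cyc_arrowClass_mul (x : E) :
    c.cyc (c.arrowClass K) x (c.len x) * c.arrowClass K x = 0 := by
  rw [arrowClass, ← mk_cyc, ← map_mul, QuiverAlgebra.mk_eq_zero_iff]
  exact TwoSidedIdeal.subset_span (Or.inl (Or.inr ⟨x, rfl⟩))

theorem cyc_arrowClass_eq {x y : E} (h : c.src x = c.src y) :
    c.cyc (c.arrowClass K) x (c.len x) = c.cyc (c.arrowClass K) y (c.len y) := by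
  rw [← sub_eq_zero, ← mk_cyc, ← mk_cyc, ← map_sub, QuiverAlgebra.mk_eq_zero_iff]
  exact TwoSidedIdeal.subset_span (Or.inl (Or.inl ⟨x, y, h, rfl⟩))

/-- Modulo the relations, a path is zero, or trivial, or an interval of a cycle. -/
theorem mk_ofPath {a b : W} (p : Quiver.Path a b) :
    (c.ideal K).ringCon.mkₐ K (ofPath p) = 0 ∨
    (p.length = 0 ∧ (c.ideal K).ringCon.mkₐ K (ofPath p) =
      (c.ideal K).ringCon.mkₐ K (vertexIdem K b)) ∨
    ∃ x, 0 < p.length ∧ p.length ≤ c.len x ∧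
      (c.ideal K).ringCon.mkₐ K (ofPath p) = c.cyc (c.arrowClass K) x p.length := by
  induction p with
  | nil => exact Or.inr (Or.inl ⟨rfl, rfl⟩)
  | @cons v w p y ih =>
    obtain ⟨z, hz⟩ := c.hom_bijective.2 ⟨v, w, y⟩
    cases hz
    rw [ofPath_cons, map_mul, Quiver.Path.length_cons]
    obtain h | ⟨h0, h⟩ | ⟨x, h0, hx, h⟩ := ih
    · rw [h, zero_mul]
      exact Or.inl rfl
    · rw [h, h0, ← map_mul, ofArrow, vertexIdem_mul_ofPath, zero_add]
      refine Or.inr (Or.inr ⟨z, one_pos, c.len_pos z, ?_⟩)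
      rw [cyc_one]
      rfl
    · rw [h]
      change c.cyc (c.arrowClass K) x p.length * c.arrowClass K z = 0 ∨ _ ∨ _
      -- Appending an arrow other than the next one gives zero by the third relations. Appending the
      -- next one lengthens the interval, unless it is already a full cycle; then the second
      -- relations apply.
      by_cases hz : z = c.next^[p.length] x
      · obtain hlt | heq := hx.lt_or_eq
        · refine Or.inr (Or.inr ⟨x, Nat.succ_pos _, hlt, ?_⟩)
          rw [cyc_succ, ← hz]
          rfl
        · left
          rw [heq, c.iterate_len] at hz
          rw [heq, hz, cyc_arrowClass_mul]
      · exact Or.inl (c.cyc_mul_of_ne (c.arrowClass_mul_of_ne K) h0 hz)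

theorem _root_.PathAlgebra.ofArrow_mul_ofArrow_mem {v w v' w' : W} (a : v ⟶ w) (b : v' ⟶ w') :
    (ofArrow a * ofArrow b : PathAlgebra K W) ∈ arrowIdealPow K W 2 := by
  rw [ofArrow, ofArrow]
  by_cases h : w = v'
  · subst h
    rw [ofPath_mul_ofPath]
    exact TwoSidedIdeal.subset_span ⟨_, _, _, le_rfl, rfl⟩
  · rw [ofPath_mul_ofPath_of_ne _ _ h]
    exact TwoSidedIdeal.zero_mem _

theorem cyc_mem (x : E) {k : ℕ} (hk : 2 ≤ k) :
    c.cyc (c.arrowElt K) x k ∈ arrowIdealPow K W 2 := by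
  obtain ⟨k, rfl⟩ := Nat.exists_eq_add_of_le' hk
  rw [cyc_succ', cyc_succ', ← mul_assoc]
  exact TwoSidedIdeal.mul_mem_right _ _ _ (ofArrow_mul_ofArrow_mem K _ _)

/-- The ideal of relations is admissible if the vertices of cycles of length one lie on no other
cycle. -/
theorem isAdmissibleIdeal [Fintype E]
    (h1 : ∀ x y, c.len x = 1 → c.src x = c.src y → x = y) : IsAdmissibleIdeal (c.ideal K) := by
  constructor
  · rw [ideal, TwoSidedIdeal.span_le]
    rintro r ((⟨x, y, hxy, rfl⟩ | ⟨x, rfl⟩) | ⟨x, y, -, rfl⟩)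
    -- A cycle of length one is a loop, which the square of the arrow ideal does not contain; here
    -- `h1` makes the relation trivial.
    · by_cases hx : c.len x = 1
      · rw [h1 x y hx hxy, sub_self]
        exact TwoSidedIdeal.zero_mem _
      · by_cases hy : c.len y = 1
        · rw [h1 y x hy hxy.symm, sub_self]
          exact TwoSidedIdeal.zero_mem _
        · have := c.len_pos x
          have := c.len_pos y
          exact TwoSidedIdeal.sub_mem _ (c.cyc_mem K x (by omega)) (c.cyc_mem K y (by omega))
    · have h : c.cyc (c.arrowElt K) x (c.len x) * c.arrowElt K x =
          c.cyc (c.arrowElt K) x (c.len x + 1) := by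
        rw [cyc_succ, c.iterate_len]
      rw [SetLike.mem_coe, h]
      exact c.cyc_mem K x (by have := c.len_pos x; omega)
    · exact ofArrow_mul_ofArrow_mem K _ _
  -- A path of this length is longer than every cycle, hence zero modulo the relations; the summand
  -- 2 meets the lower bound on the exponent.
  · refine ⟨2 + ∑ x, c.len x, by omega, ?_⟩
    rw [arrowIdealPow, TwoSidedIdeal.span_le]
    rintro r ⟨a, b, p, hp, rfl⟩
    rw [SetLike.mem_coe, ← QuiverAlgebra.mk_eq_zero_iff]
    obtain h | ⟨h0, -⟩ | ⟨x, -, hx, -⟩ := c.mk_ofPath K p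
    · exact h
    · omega
    · have := Finset.single_le_sum (f := c.len) (fun _ _ => Nat.zero_le _) (Finset.mem_univ x)
      omega

/-- The third relations suffice: a product of arrows outside the ideal consists of an arrow and its
successor under `next`, and `next` is injective. -/
theorem isSpecialMultiserialIdeal : IsSpecialMultiserialIdeal (c.ideal K) := by
  have key : ∀ a b : Arr W, ofArrow a.2.2 * ofArrow b.2.2 ∉ c.ideal K →
      ∃ x : E, a = ⟨_, _, c.hom x⟩ ∧ b = ⟨_, _, c.hom (c.next x)⟩ := by
    intro a b h
    obtain ⟨x, rfl⟩ := c.hom_bijective.2 a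
    obtain ⟨y, rfl⟩ := c.hom_bijective.2 b
    refine ⟨x, rfl, ?_⟩
    by_cases hy : y = c.next x
    · rw [hy]
    · exact absurd (show _ ∈ c.ideal K from TwoSidedIdeal.subset_span (Or.inr ⟨x, y, hy, rfl⟩)) h
  intro v w a
  constructor
  · rintro ⟨z, b⟩ ⟨z', b'⟩ h h'
    obtain ⟨x, hx, hb⟩ := key ⟨v, w, a⟩ ⟨w, z, b⟩ h
    obtain ⟨x', hx', hb'⟩ := key ⟨v, w, a⟩ ⟨w, z', b'⟩ h'
    have hxx : x = x' := c.hom_bijective.1 (hx.symm.trans hx')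
    subst hxx
    have := hb.trans hb'.symm
    rw [Sigma.mk.injEq] at this
    exact eq_of_heq this.2
  · rintro ⟨z, b⟩ ⟨z', b'⟩ h h'
    obtain ⟨x, hx, hb⟩ := key ⟨z, v, b⟩ ⟨v, w, a⟩ h
    obtain ⟨x', hx', hb'⟩ := key ⟨z', v, b'⟩ ⟨v, w, a⟩ h'
    have hxx : x = x' := c.next_injective (c.hom_bijective.1 (hb.symm.trans hb'))
    subst hxx
    have := hx.trans hx'.symm
    cases this
    rfl

end Algebra

end CyclicQuiver

/-! # Cutting the cycles: the dual basis of a monomial algebra -/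

open PathAlgebra

/-- A linear map on the quotient of a path algebra. -/
noncomputable def QuiverAlgebra.liftLinear {K : Type u} [Field K] {V : Type u} [Quiver.{u} V]
    [Fintype V] {I : TwoSidedIdeal (PathAlgebra K V)} (f : PathAlgebra K V →ₗ[K] K)
    (h : ∀ x ∈ I, f x = 0) : QuiverAlgebra I →ₗ[K] K where
  toFun := Quotient.lift f fun x y hxy => by
    rw [← sub_eq_zero, ← map_sub]
    exact h _ ((I.rel_iff x y).1 hxy)
  map_add' := by
    rintro ⟨x⟩ ⟨y⟩
    exact map_add f x y
  map_smul' := by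
    rintro k ⟨x⟩
    exact map_smul f k x

theorem List.isChain_iterate {α : Type*} (f : α → α) (a : α) (n : ℕ) :
    (List.iterate f a n).IsChain fun x y => y = f x := by
  induction n generalizing a with
  | zero => exact List.isChain_nil
  | succ n ih =>
    rw [List.iterate]
    cases n with
    | zero => exact List.isChain_singleton _
    | succ n => exact List.isChain_cons_cons.2 ⟨rfl, ih (f a)⟩

theorem List.iterate_succ' {α : Type*} (f : α → α) (a : α) (n : ℕ) :
    List.iterate f a (n + 1) = List.iterate f a n ++ [f^[n] a] := by
  induction n generalizing a with
  | zero => rfl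
  | succ n ih => rw [List.iterate, ih]; rfl

/-- A choice of one arrow on every cycle of a cyclic quiver together with an identification of the
other arrows with those of a quiver with relations, such that exactly the products of consecutive
arrows are not relations. -/
structure CyclicQuiver.Cut {W : Type u} [Quiver.{u} W] {E : Type u} (c : CyclicQuiver W E)
    {K : Type u} [Field K] {V : Type u} [Quiver.{u} V] [Fintype V]
    (I : TwoSidedIdeal (PathAlgebra K V)) where
  /-- the identification of the vertices -/
  vtx : W ≃ V
  /-- the distance to the chosen arrow -/
  depth : E → ℕ
  depth_lt : ∀ x, depth x < c.len x
  depth_next : ∀ x k, depth x = k + 1 → depth (c.next x) = k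
  depth_zero : ∀ x, depth x = 0 → depth (c.next x) + 1 = c.len x
  /-- the arrow of the cyclic quiver that is given by an arrow -/
  pos : Arr V → E
  pos_injective : Function.Injective pos
  depth_pos : ∀ a, 0 < depth (pos a)
  exists_pos : ∀ x, 0 < depth x → ∃ a, pos a = x
  vtx_src : ∀ a, vtx (c.src (pos a)) = a.1
  vtx_tgt : ∀ a, vtx (c.src (c.next (pos a))) = a.2.1
  pos_eq_iff : ∀ a b, pos b = c.next (pos a) ↔ Follows I a b

namespace CyclicQuiver.Cut

variable {W : Type u} [Quiver.{u} W] {E : Type u} {c : CyclicQuiver W E}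
  {K : Type u} [Field K] {V : Type u} [Quiver.{u} V] [Fintype V]
  {I : TwoSidedIdeal (PathAlgebra K V)} (d : c.Cut I)

theorem depth_iterate (x : E) (k : ℕ) (hk : k ≤ d.depth x) :
    d.depth (c.next^[k] x) = d.depth x - k := by
  induction k with
  | zero => rfl
  | succ k ih =>
    rw [Function.iterate_succ_apply']
    refine d.depth_next _ _ ?_
    rw [ih (by omega)]
    omega

/-- The path `a → b` is the interval of length `k` that starts with `y`. -/
def IsInterval (y : E) (k : ℕ) {a b : V} (q : Quiver.Path a b) : Prop :=
  a = d.vtx (c.src y) ∧ b = d.vtx (c.src (c.next^[k] y)) ∧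
    (arrows q).map d.pos = List.iterate c.next y k

open Classical in
/-- The coefficient of an interval in an element of the path algebra. -/
noncomputable def coeff (y : E) (k : ℕ) : PathAlgebra K V →ₗ[K] K :=
  lin fun _ _ q => if d.IsInterval y k q then 1 else 0

open Classical in
theorem coeff_ofPath (y : E) (k : ℕ) {a b : V} (q : Quiver.Path a b) :
    d.coeff y k (ofPath q) = if d.IsInterval y k q then 1 else 0 := lin_ofPath _ _

theorem isChain_arrows_iff {a b : V} (q : Quiver.Path a b) :
    (arrows q).IsChain (Follows I) ↔
      ((arrows q).map d.pos).IsChain fun x y => y = c.next x := by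
  rw [List.isChain_map]
  simp only [d.pos_eq_iff]

theorem IsInterval.isChain {y : E} {k : ℕ} {a b : V} {q : Quiver.Path a b}
    (h : d.IsInterval y k q) : (arrows q).IsChain (Follows I) := by
  rw [d.isChain_arrows_iff, h.2.2]
  exact List.isChain_iterate _ _ _

/-- Intervals are chains, and the elements of `I` vanish on chains. So the coefficients descend to
the quotient by `I`. -/
theorem coeff_eq_zero (hI : IsQuadraticMonomialIdeal I) (y : E) (k : ℕ) (x : PathAlgebra K V)
    (hx : x ∈ I) : d.coeff y k x = 0 := by
  classical
  rw [mem_iff_of_isQuadraticMonomialIdeal hI] at hx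
  rw [coeff, lin_apply]
  refine Finset.sum_eq_zero fun a _ => Finset.sum_eq_zero fun b _ => ?_
  rw [Finsupp.linearCombination_apply]
  refine Finset.sum_eq_zero fun q _ => ?_
  change x a b q • (if d.IsInterval y k q then (1 : K) else 0) = 0
  by_cases h : d.IsInterval y k q
  · rw [hx a b q h.isChain, zero_smul]
  · rw [if_neg h, smul_zero]

/-- The element of the dual space given by the coefficient of an interval. -/
noncomputable def dual (hI : IsQuadraticMonomialIdeal I) (y : E) (k : ℕ) :
    DualBimodule K (QuiverAlgebra I) :=
  QuiverAlgebra.liftLinear (d.coeff y k) (d.coeff_eq_zero hI y k)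

variable (hI : IsQuadraticMonomialIdeal I)

theorem dual_mk (y : E) (k : ℕ) (x : PathAlgebra K V) :
    d.dual hI y k (I.ringCon.mkₐ K x) = d.coeff y k x := rfl

variable (I) in
/-- The class of an arrow. -/
noncomputable def arrow (a : Arr V) : QuiverAlgebra I := I.ringCon.mkₐ K (ofArrow a.2.2)

variable (I) in
/-- The class of a trivial path. -/
noncomputable def idem (v : V) : QuiverAlgebra I := I.ringCon.mkₐ K (vertexIdem K v)

theorem dual_ext {f g : DualBimodule K (QuiverAlgebra I)}
    (h : ∀ (a b : V) (q : Quiver.Path a b),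
      f (I.ringCon.mkₐ K (ofPath q)) = g (I.ringCon.mkₐ K (ofPath q))) : f = g := by
  refine DualBimodule.ext fun x => ?_
  obtain ⟨x, rfl⟩ := I.ringCon.mkₐ_surjective (α := K) x
  exact LinearMap.congr_fun (linearMap_ext
    (f := LinearMap.comp (show Module.Dual K (QuiverAlgebra I) from f)
      (I.ringCon.mkₐ K).toLinearMap)
    (g := LinearMap.comp (show Module.Dual K (QuiverAlgebra I) from g)
      (I.ringCon.mkₐ K).toLinearMap) h) x

theorem isInterval_zero_iff (y : E) {a b : V} (q : Quiver.Path a b) :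
    d.IsInterval y 0 q ↔ a = d.vtx (c.src y) ∧ b = d.vtx (c.src y) ∧ arrows q = [] := by
  simp [IsInterval, List.iterate]

/-- An interval of length zero is a trivial path and remembers only the vertex. This is the source
of the first kind of relations. -/
theorem dual_zero_eq {y z : E} (h : c.src y = c.src z) : d.dual hI y 0 = d.dual hI z 0 := by
  classical
  refine dual_ext fun a b q => ?_
  simp only [dual_mk, coeff_ofPath, isInterval_zero_iff, h]

theorem op_arrow_smul_dual_zero (a : Arr V) (y : E) :
    MulOpposite.op (arrow I a) • d.dual hI y 0 = 0 := by
  classical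
  refine dual_ext fun v w q => ?_
  rw [DualBimodule.op_smul_apply, MulOpposite.unop_op, arrow, ← map_mul, dual_mk]
  obtain ⟨s, t, x⟩ := a
  by_cases h : t = v
  · subst h
    rw [ofArrow, ofPath_mul_ofPath, coeff_ofPath, if_neg]
    · rfl
    · rw [isInterval_zero_iff, arrows_comp]
      simp [Quiver.Hom.toPath, arrows]
  · rw [ofArrow, ofPath_mul_ofPath_of_ne _ _ h, map_zero]
    rfl

theorem arrow_smul_dual_zero (a : Arr V) (y : E) : arrow I a • d.dual hI y 0 = 0 := by
  classical
  refine dual_ext fun v w q => ?_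
  rw [DualBimodule.smul_apply, arrow, ← map_mul, dual_mk]
  obtain ⟨s, t, x⟩ := a
  by_cases h : w = s
  · subst h
    rw [← ofPath_cons, coeff_ofPath, if_neg]
    · rfl
    · rw [isInterval_zero_iff, arrows_cons]
      simp
  · rw [ofArrow, ofPath_mul_ofPath_of_ne _ _ h, map_zero]
    rfl

-- As `(f a)(x) = f(a x)`, the right action strips the first arrow from the path that the functional
-- detects.
open Classical in
theorem op_arrow_smul_dual_succ (a : Arr V) (y : E) (k : ℕ) :
    MulOpposite.op (arrow I a) • d.dual hI y (k + 1) =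
      if d.pos a = y then d.dual hI (c.next y) k else 0 := by
  refine dual_ext fun v w q => ?_
  rw [DualBimodule.op_smul_apply, MulOpposite.unop_op, arrow, ← map_mul, dual_mk]
  have hs := d.vtx_src a
  have ht := d.vtx_tgt a
  obtain ⟨s, t, x⟩ := a
  dsimp only at hs ht
  by_cases h : t = v
  · subst h
    rw [ofArrow, ofPath_mul_ofPath, coeff_ofPath]
    have hiff : d.IsInterval y (k + 1) (x.toPath.comp q) ↔
        d.pos ⟨s, t, x⟩ = y ∧ d.IsInterval (c.next y) k q := by
      rw [IsInterval, IsInterval, arrows_comp, List.iterate]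
      simp only [Quiver.Hom.toPath, arrows, List.nil_append, List.cons_append, List.map_cons,
        List.cons.injEq, Function.iterate_succ_apply]
      constructor
      · rintro ⟨-, h2, rfl, h4⟩
        exact ⟨rfl, ht.symm, h2, h4⟩
      · rintro ⟨rfl, -, h2, h4⟩
        exact ⟨hs.symm, h2, rfl, h4⟩
    rw [if_congr hiff rfl rfl]
    by_cases hy : d.pos ⟨s, t, x⟩ = y
    · rw [if_pos hy, dual_mk, coeff_ofPath]
      simp only [hy, true_and]
    · rw [if_neg hy, if_neg (fun h => hy h.1)]
      rfl
  · rw [ofArrow, ofPath_mul_ofPath_of_ne _ _ h, map_zero]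
    split_ifs with hy
    · rw [dual_mk, coeff_ofPath, if_neg]
      rintro ⟨h1, -⟩
      apply h
      rw [h1, ← hy, ht]
    · rfl

-- As `(a f)(x) = f(x a)`, the left action strips the last arrow, which sits at `next^[k] y`.
open Classical in
theorem arrow_smul_dual_succ (a : Arr V) (y : E) (k : ℕ) :
    arrow I a • d.dual hI y (k + 1) = if d.pos a = c.next^[k] y then d.dual hI y k else 0 := by
  refine dual_ext fun v w q => ?_
  rw [DualBimodule.smul_apply, arrow, ← map_mul, dual_mk]
  have hs := d.vtx_src a
  have ht := d.vtx_tgt a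
  obtain ⟨s, t, x⟩ := a
  dsimp only at hs ht
  by_cases h : w = s
  · subst h
    rw [← ofPath_cons, coeff_ofPath]
    have hiff : d.IsInterval y (k + 1) (q.cons x) ↔
        d.pos ⟨w, t, x⟩ = c.next^[k] y ∧ d.IsInterval y k q := by
      rw [IsInterval, IsInterval, arrows_cons, List.iterate_succ', List.map_append,
        Function.iterate_succ_apply']
      constructor
      · rintro ⟨h1, h2, h3⟩
        obtain ⟨h3, h4⟩ := List.append_inj' h3 rfl
        rw [List.map_singleton, List.singleton_inj] at h4
        exact ⟨h4, h1, by rw [← h4, hs], h3⟩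
      · rintro ⟨h1, h2, -, h4⟩
        refine ⟨h2, by rw [← h1, ht], ?_⟩
        rw [h4, List.map_singleton, h1]
    rw [if_congr hiff rfl rfl]
    by_cases hy : d.pos ⟨w, t, x⟩ = c.next^[k] y
    · rw [if_pos hy, dual_mk, coeff_ofPath]
      simp only [hy, true_and]
    · rw [if_neg hy, if_neg (fun h => hy h.1)]
      rfl
  · rw [ofArrow, ofPath_mul_ofPath_of_ne _ _ h, map_zero]
    split_ifs with hy
    · rw [dual_mk, coeff_ofPath, if_neg]
      rintro ⟨-, h1, -⟩
      apply h
      rw [h1, ← hy, hs]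
    · rfl

theorem op_idem_smul_dual (y : E) (k : ℕ) :
    MulOpposite.op (idem I (d.vtx (c.src y))) • d.dual hI y k = d.dual hI y k := by
  classical
  refine dual_ext fun v w q => ?_
  rw [DualBimodule.op_smul_apply, MulOpposite.unop_op, idem, ← map_mul, dual_mk, dual_mk]
  by_cases h : d.vtx (c.src y) = v
  · rw [h, vertexIdem_mul_ofPath]
  · rw [vertexIdem, ofPath_mul_ofPath_of_ne _ _ h, map_zero, coeff_ofPath, if_neg]
    rintro ⟨h1, -⟩
    exact h h1.symm

theorem idem_smul_dual (y : E) (k : ℕ) :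
    idem I (d.vtx (c.src (c.next^[k] y))) • d.dual hI y k = d.dual hI y k := by
  classical
  refine dual_ext fun v w q => ?_
  rw [DualBimodule.smul_apply, idem, ← map_mul, dual_mk, dual_mk]
  by_cases h : w = d.vtx (c.src (c.next^[k] y))
  · subst h
    rw [ofPath_mul_vertexIdem]
  · rw [vertexIdem, ofPath_mul_ofPath_of_ne _ _ h, map_zero, coeff_ofPath, if_neg]
    rintro ⟨-, h1, -⟩
    exact h h1

theorem dual_zero_one (y : E) : d.dual hI y 0 1 = 1 := by
  classical
  rw [← map_one (I.ringCon.mkₐ K), dual_mk, one_eq_sum, map_sum,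
    Finset.sum_eq_single (d.vtx (c.src y))]
  · rw [coeff_ofPath, if_pos]
    exact (d.isInterval_zero_iff y _).2 ⟨rfl, rfl, rfl⟩
  · intro v _ hv
    rw [coeff_ofPath, if_neg]
    rintro ⟨h, -⟩
    exact hv h
  · simp

theorem dual_one (y : E) {k : ℕ} (hk : 0 < k) : d.dual hI y k 1 = 0 := by
  classical
  rw [← map_one (I.ringCon.mkₐ K), dual_mk, one_eq_sum, map_sum]
  refine Finset.sum_eq_zero fun v _ => ?_
  rw [coeff_ofPath, if_neg]
  rintro ⟨-, -, h⟩
  have := congrArg List.length h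
  simp [arrows] at this
  omega

/-- Every path that contains no relation is an interval. -/
theorem exists_isInterval {a b : V} (q : Quiver.Path a b) (hq : (arrows q).IsChain (Follows I)) :
    ∃ y k, k ≤ d.depth y ∧ d.IsInterval y k q := by
  induction q with
  | nil =>
    obtain ⟨w, rfl⟩ := d.vtx.surjective a
    obtain ⟨y, rfl⟩ := c.src_surjective w
    exact ⟨y, 0, Nat.zero_le _, (d.isInterval_zero_iff y _).2 ⟨rfl, rfl, rfl⟩⟩
  | @cons v w q x ih =>
    rw [arrows_cons, List.isChain_append] at hq
    obtain ⟨y, k, hk, h1, h2, h3⟩ := ih hq.1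
    have hs := d.vtx_src ⟨v, w, x⟩
    have ht := d.vtx_tgt ⟨v, w, x⟩
    have hd := d.depth_pos ⟨v, w, x⟩
    cases k with
    -- A trivial interval may have been recorded at any arrow that starts at the vertex; with its
    -- first arrow the path gets its true starting place.
    | zero =>
      have h0 : arrows q = [] := List.map_eq_nil_iff.1 h3
      have hva : a = v := h1.trans h2.symm
      refine ⟨d.pos ⟨v, w, x⟩, 1, hd, hva.trans hs.symm, ht.symm, ?_⟩
      rw [arrows_cons, h0]
      rfl
    | succ k =>
      have hx : d.pos ⟨v, w, x⟩ = c.next^[k + 1] y := by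
        rw [List.iterate_succ'] at h3
        obtain ⟨l, l', hl, -, hl'⟩ := List.map_eq_append_iff.1 h3
        obtain ⟨e, rfl, he⟩ := List.map_eq_singleton_iff.1 hl'
        rw [Function.iterate_succ_apply', ← he, d.pos_eq_iff]
        refine hq.2.2 e ?_ _ rfl
        rw [hl, List.getLast?_concat]
        rfl
      refine ⟨y, k + 2, ?_, h1, ?_, ?_⟩
      · rw [hx, d.depth_iterate _ _ hk] at hd
        omega
      · rw [Function.iterate_succ_apply', ← hx, ht]
      · rw [arrows_cons, List.map_append, h3, List.iterate_succ' _ _ (k + 1), ← hx]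
        rfl

/-- The coefficients of the intervals are coordinates. -/
theorem eq_zero_of_dual_eq_zero (x : QuiverAlgebra I)
    (h : ∀ y k, k ≤ d.depth y → d.dual hI y k x = 0) : x = 0 := by
  classical
  obtain ⟨x, rfl⟩ := I.ringCon.mkₐ_surjective (α := K) x
  rw [QuiverAlgebra.mk_eq_zero_iff, mem_iff_of_isQuadraticMonomialIdeal hI]
  intro a b q hq
  obtain ⟨y, k, hk, hyk⟩ := d.exists_isInterval q hq
  rw [← h y k hk, dual_mk, coeff, lin_apply, Finset.sum_eq_single a, Finset.sum_eq_single b]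
  · rw [Finsupp.linearCombination_apply, Finsupp.sum, Finset.sum_eq_single q]
    · rw [if_pos hyk, smul_eq_mul, mul_one]
    · intro q' _ hq'
      rw [if_neg, smul_zero]
      rintro ⟨-, -, h3⟩
      apply hq'
      apply arrows_injective
      exact List.map_injective_iff.2 d.pos_injective (h3.trans hyk.2.2.symm)
    · intro hq
      rw [Finsupp.notMem_support_iff.1 hq, zero_smul]
  · intro b' _ hb'
    rw [Finsupp.linearCombination_apply]
    refine Finset.sum_eq_zero fun q' _ => ?_
    change x a b' q' • (if d.IsInterval y k q' then (1 : K) else 0) = 0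
    rw [if_neg, smul_zero]
    rintro ⟨-, h2, -⟩
    exact hb' (h2.trans hyk.2.1.symm)
  · simp
  · intro a' _ ha'
    refine Finset.sum_eq_zero fun b _ => ?_
    rw [Finsupp.linearCombination_apply]
    refine Finset.sum_eq_zero fun q' _ => ?_
    change x a' b q' • (if d.IsInterval y k q' then (1 : K) else 0) = 0
    rw [if_neg, smul_zero]
    rintro ⟨h1, -⟩
    exact ha' (h1.trans hyk.1.symm)
  · simp

end CyclicQuiver.Cut

/-! # The trivial extension of a monomial algebra as the algebra of a cyclic quiver -/

open PathAlgebra TrivSqZeroExt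

namespace CyclicQuiver.Cut

variable {W : Type u} [Quiver.{u} W] {E : Type u} {c : CyclicQuiver W E}
  {K : Type u} [Field K] {V : Type u} [Quiver.{u} V] [Fintype V]
  {I : TwoSidedIdeal (PathAlgebra K V)} (d : c.Cut I) (hI : IsQuadraticMonomialIdeal I)

open Classical in
/-- The element of the trivial extension given by an arrow of the cyclic quiver. -/
noncomputable def theta (x : E) : TrivialExtension K (QuiverAlgebra I) :=
  if h : ∃ a, d.pos a = x then inl (arrow I h.choose)
  -- Without the chosen arrow `x`, its cycle is a maximal path: it starts at `next x` and has `len x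
  -- - 1` arrows. The chosen arrow becomes the dual of this path.
  else inr (d.dual hI (c.next x) (c.len x - 1))

theorem theta_pos (a : Arr V) : d.theta hI (d.pos a) = inl (arrow I a) := by
  have h : ∃ b, d.pos b = d.pos a := ⟨a, rfl⟩
  rw [theta, dif_pos h, d.pos_injective h.choose_spec]

theorem theta_of_depth_eq_zero {x : E} (hx : d.depth x = 0) :
    d.theta hI x = inr (d.dual hI (c.next x) (c.len x - 1)) := by
  rw [theta, dif_neg]
  rintro ⟨a, rfl⟩
  exact (d.depth_pos a).ne' hx

theorem theta_mul_of_ne (x y : E) (h : y ≠ c.next x) : d.theta hI x * d.theta hI y = 0 := by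
  have hlen := c.len_pos
  obtain hx | hx := Nat.eq_zero_or_pos (d.depth x) <;> obtain hy | hy := Nat.eq_zero_or_pos (d.depth y)
  · rw [d.theta_of_depth_eq_zero hI hx, d.theta_of_depth_eq_zero hI hy, inr_mul_inr]
  · obtain ⟨b, rfl⟩ := d.exists_pos y hy
    rw [d.theta_of_depth_eq_zero hI hx, theta_pos, inr_mul_inl]
    cases hn : c.len x - 1 with
    | zero => rw [op_arrow_smul_dual_zero, inr_zero]
    | succ n => rw [op_arrow_smul_dual_succ, if_neg h, inr_zero]
  · obtain ⟨a, rfl⟩ := d.exists_pos x hx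
    rw [d.theta_of_depth_eq_zero hI hy, theta_pos, inl_mul_inr]
    cases hn : c.len y - 1 with
    | zero => rw [arrow_smul_dual_zero, inr_zero]
    -- The arrow `a` acts nontrivially only if it is the last arrow of the maximal path, but then
    -- the chosen arrow `y` is its successor.
    | succ n =>
      rw [arrow_smul_dual_succ, if_neg, inr_zero]
      intro h'
      apply h
      rw [h', ← Function.iterate_succ_apply, ← Function.iterate_succ_apply' c.next (n + 1) y]
      have : (n + 1).succ = c.len y := by have := hlen y; omega
      rw [this, c.iterate_len]
  · obtain ⟨a, rfl⟩ := d.exists_pos x hx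
    obtain ⟨b, rfl⟩ := d.exists_pos y hy
    rw [theta_pos, theta_pos, ← inl_mul]
    have : arrow I a * arrow I b = 0 := by
      rw [arrow, arrow, ← map_mul, QuiverAlgebra.mk_eq_zero_iff]
      by_contra hab
      exact h ((d.pos_eq_iff a b).2 hab)
    rw [this, inl_zero]

theorem inr_dual_mul_cyc (y : E) (r k : ℕ) (hk : k ≤ d.depth y) (hr : k ≤ r) :
    inr (d.dual hI y r) * c.cyc (d.theta hI) y k = inr (d.dual hI (c.next^[k] y) (r - k)) := by
  induction k generalizing y r with
  | zero => rw [cyc_zero, mul_one]; rfl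
  | succ k ih =>
    obtain ⟨a, rfl⟩ := d.exists_pos y (by omega)
    obtain ⟨r, rfl⟩ := Nat.exists_eq_add_of_le' (Nat.one_le_of_lt hr)
    obtain ⟨m, hm⟩ := Nat.exists_eq_add_of_le' (d.depth_pos a)
    rw [cyc_succ', ← mul_assoc, theta_pos, inr_mul_inl, op_arrow_smul_dual_succ, if_pos rfl,
      ih _ _ (by rw [d.depth_next _ _ hm]; omega) (by omega), Function.iterate_succ_apply]
    congr 2
    omega

theorem cyc_theta_of_le (x : E) (k : ℕ) (hk : k ≤ d.depth x) :
    ∃ b, c.cyc (d.theta hI) x k = inl b := by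
  induction k generalizing x with
  | zero => exact ⟨1, inl_one _⟩
  | succ k ih =>
    obtain ⟨a, rfl⟩ := d.exists_pos x (by omega)
    obtain ⟨m, hm⟩ := Nat.exists_eq_add_of_le' (d.depth_pos a)
    obtain ⟨b, hb⟩ := ih (c.next (d.pos a)) (by rw [d.depth_next _ _ hm]; omega)
    exact ⟨arrow I a * b, by rw [cyc_succ', theta_pos, hb, inl_mul]⟩

/-- The central computation: an interval through the chosen arrow becomes the dual of the
complementary interval. The arrows after the chosen one strip the dual of the maximal path from the
front, those before it strip it from the end. The induction is on the number of arrows before the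
chosen one. -/
theorem cyc_theta_of_lt (x : E) (k : ℕ) (hk : d.depth x < k) (hk' : k ≤ c.len x) :
    c.cyc (d.theta hI) x k = inr (d.dual hI (c.next^[k] x) (c.len x - k)) := by
  obtain ⟨k, rfl⟩ := Nat.exists_eq_add_of_le' (Nat.one_le_of_lt hk)
  induction hn : d.depth x generalizing x k with
  | zero =>
    have h := d.depth_zero x hn
    rw [cyc_succ', d.theta_of_depth_eq_zero hI hn,
      d.inr_dual_mul_cyc hI _ _ _ (by omega) (by omega), Function.iterate_succ_apply]
    congr 2
    omega
  | succ n ih =>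
    obtain ⟨a, rfl⟩ := d.exists_pos x (by omega)
    obtain ⟨k, rfl⟩ := Nat.exists_eq_add_of_le' (show 1 ≤ k by omega)
    have h := d.depth_next _ _ hn
    rw [cyc_succ', ih (c.next (d.pos a)) k (by omega) (by rw [c.len_next]; omega) h, theta_pos,
      inl_mul_inr, c.len_next]
    obtain ⟨m, hm⟩ := Nat.exists_eq_add_of_le' (show 1 ≤ c.len (d.pos a) - (k + 1) by omega)
    rw [hm, arrow_smul_dual_succ, if_pos]
    · rw [Function.iterate_succ_apply c.next (k + 1)]
      congr 2
      omega
    · rw [← Function.iterate_add_apply, ← Function.iterate_succ_apply]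
      rw [show (m + (k + 1)).succ = c.len (d.pos a) by omega, c.iterate_len]

theorem cyc_theta_len (x : E) : c.cyc (d.theta hI) x (c.len x) = inr (d.dual hI x 0) := by
  rw [d.cyc_theta_of_lt hI x _ (d.depth_lt x) le_rfl, c.iterate_len, Nat.sub_self]

theorem cyc_theta_len_mul (x : E) :
    c.cyc (d.theta hI) x (c.len x) * d.theta hI x = 0 := by
  rw [cyc_theta_len]
  obtain hx | hx := Nat.eq_zero_or_pos (d.depth x)
  · rw [d.theta_of_depth_eq_zero hI hx, inr_mul_inr]
  · obtain ⟨a, rfl⟩ := d.exists_pos x hx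
    rw [theta_pos, inr_mul_inl, op_arrow_smul_dual_zero, inr_zero]

/-- The symmetrizing form of a trivial extension. -/
noncomputable def _root_.TrivialExtension.tau (K : Type u) [Field K] (A : Type u) [Ring A]
    [Algebra K A] : TrivialExtension K A →ₗ[K] K where
  toFun x := x.snd 1
  map_add' _ _ := rfl
  map_smul' _ _ := rfl

theorem _root_.TrivialExtension.tau_inl {A : Type u} [Ring A] [Algebra K A] (a : A) :
    TrivialExtension.tau K A (inl a) = 0 := rfl

theorem _root_.TrivialExtension.tau_inr {A : Type u} [Ring A] [Algebra K A]
    (f : DualBimodule K A) : TrivialExtension.tau K A (inr f) = f 1 := rfl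

/-- Among the functionals dual to intervals only those of trivial paths are nonzero at 1, and these
are the values of full cycles. -/
theorem tau_cyc (x : E) (k : ℕ) (hk : k ≤ c.len x) :
    TrivialExtension.tau K _ (c.cyc (d.theta hI) x k) = if k = c.len x then 1 else 0 := by
  split_ifs with h
  · rw [h, cyc_theta_len, TrivialExtension.tau_inr, dual_zero_one]
  · obtain h' | h' := le_or_gt k (d.depth x)
    · obtain ⟨b, hb⟩ := d.cyc_theta_of_le hI x k h'
      rw [hb, TrivialExtension.tau_inl]
    · rw [d.cyc_theta_of_lt hI x k h' hk, TrivialExtension.tau_inr, dual_one]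
      omega

open Classical in
theorem tau_cyc_mul_cyc (x y : E) (k l : ℕ) (hk : 0 < k) (hl : 0 < l) :
    TrivialExtension.tau K _ (c.cyc (d.theta hI) x k * c.cyc (d.theta hI) y l) =
      if y = c.next^[k] x ∧ k + l = c.len x then 1 else 0 := by
  by_cases hy : y = c.next^[k] x
  · subst hy
    rw [← cyc_add]
    obtain h | h := le_or_gt (k + l) (c.len x)
    · rw [d.tau_cyc hI x _ h]
      simp
    · rw [c.cyc_eq_zero (d.cyc_theta_len_mul hI) h, map_zero, if_neg (by omega)]
  · rw [c.cyc_mul_cyc_of_ne (d.theta_mul_of_ne hI) hk hl hy, map_zero, if_neg (fun h => hy h.1)]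

/-! ## The homomorphism -/

/-- The idempotent of the trivial extension given by a vertex. -/
noncomputable def vertex (w : W) : TrivialExtension K (QuiverAlgebra I) := inl (idem I (d.vtx w))

theorem vertex_mul_vertex (w : W) : d.vertex w * d.vertex w = d.vertex w := by
  rw [vertex, ← inl_mul, idem, ← map_mul]
  exact congrArg (fun x => inl (I.ringCon.mkₐ K x)) (vertexIdem_mul_ofPath _)

theorem vertex_mul_vertex_of_ne (w w' : W) (h : w ≠ w') : d.vertex w * d.vertex w' = 0 := by
  rw [vertex, vertex, ← inl_mul, idem, idem, ← map_mul, vertexIdem, vertexIdem,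
    ofPath_mul_ofPath_of_ne _ _ (d.vtx.injective.ne h), map_zero, inl_zero]

theorem sum_vertex [Fintype W] : ∑ w, d.vertex w = 1 := by
  have h : ∀ v, (inl (idem I v) : TrivialExtension K (QuiverAlgebra I)) =
      (inlAlgHom K (QuiverAlgebra I) (DualBimodule K (QuiverAlgebra I))).comp (I.ringCon.mkₐ K)
        (vertexIdem K v) := fun v => rfl
  simp only [vertex]
  rw [Equiv.sum_comp d.vtx fun v => (inl (idem I v) : TrivialExtension K (QuiverAlgebra I))]
  simp only [h]
  rw [← map_sum]
  simp only [vertexIdem]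
  rw [← one_eq_sum, map_one]

theorem vertex_mul_theta (x : E) : d.vertex (c.src x) * d.theta hI x = d.theta hI x := by
  obtain hx | hx := Nat.eq_zero_or_pos (d.depth x)
  · rw [d.theta_of_depth_eq_zero hI hx, vertex, inl_mul_inr]
    have h := d.idem_smul_dual hI (c.next x) (c.len x - 1)
    rw [← Function.iterate_succ_apply, Nat.succ_eq_add_one,
      Nat.sub_add_cancel (c.len_pos x), c.iterate_len] at h
    rw [h]
  · obtain ⟨a, rfl⟩ := d.exists_pos x hx
    rw [theta_pos, vertex, d.vtx_src, ← inl_mul, idem, arrow, ← map_mul, ofArrow,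
      vertexIdem_mul_ofPath]

theorem theta_mul_vertex (x : E) :
    d.theta hI x * d.vertex (c.src (c.next x)) = d.theta hI x := by
  obtain hx | hx := Nat.eq_zero_or_pos (d.depth x)
  · rw [d.theta_of_depth_eq_zero hI hx, vertex, inr_mul_inl, op_idem_smul_dual]
  · obtain ⟨a, rfl⟩ := d.exists_pos x hx
    rw [theta_pos, vertex, d.vtx_tgt, ← inl_mul, idem, arrow, ← map_mul, ofArrow,
      ofPath_mul_vertexIdem]

theorem vertex_mul_cyc (w : W) (x : E) (k : ℕ) (hk : 0 < k) (h : w ≠ c.src x) :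
    d.vertex w * c.cyc (d.theta hI) x k = 0 := by
  obtain ⟨k, rfl⟩ := Nat.exists_eq_add_of_le' hk
  rw [cyc_succ', ← d.vertex_mul_theta hI x, ← mul_assoc, ← mul_assoc,
    d.vertex_mul_vertex_of_ne _ _ h, zero_mul, zero_mul]

theorem vertex_src_mul_cyc (x : E) (k : ℕ) (hk : 0 < k) :
    d.vertex (c.src x) * c.cyc (d.theta hI) x k = c.cyc (d.theta hI) x k := by
  obtain ⟨k, rfl⟩ := Nat.exists_eq_add_of_le' hk
  rw [cyc_succ', ← mul_assoc, vertex_mul_theta]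

theorem cyc_mul_vertex (w : W) (x : E) (k : ℕ) (hk : 0 < k) (h : c.src (c.next^[k] x) ≠ w) :
    c.cyc (d.theta hI) x k * d.vertex w = 0 := by
  obtain ⟨k, rfl⟩ := Nat.exists_eq_add_of_le' hk
  rw [Function.iterate_succ_apply'] at h
  rw [cyc_succ, ← d.theta_mul_vertex hI (c.next^[k] x), mul_assoc, mul_assoc,
    d.vertex_mul_vertex_of_ne _ _ h, mul_zero, mul_zero]

theorem cyc_mul_vertex_src (x : E) (k : ℕ) (hk : 0 < k) :
    c.cyc (d.theta hI) x k * d.vertex (c.src (c.next^[k] x)) = c.cyc (d.theta hI) x k := by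
  obtain ⟨k, rfl⟩ := Nat.exists_eq_add_of_le' hk
  rw [Function.iterate_succ_apply', cyc_succ, mul_assoc, theta_mul_vertex]

open Classical in
theorem tau_vertex_mul_cyc (w : W) (x : E) (k : ℕ) (hk : 0 < k) (hk' : k ≤ c.len x) :
    TrivialExtension.tau K _ (d.vertex w * c.cyc (d.theta hI) x k) =
      if w = c.src x ∧ k = c.len x then 1 else 0 := by
  by_cases h : w = c.src x
  · subst h
    rw [d.vertex_src_mul_cyc hI x k hk, d.tau_cyc hI x k hk']
    simp
  · rw [d.vertex_mul_cyc hI w x k hk h, map_zero, if_neg (fun h' => h h'.1)]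

open Classical in
theorem tau_cyc_mul_vertex (w : W) (x : E) (k : ℕ) (hk : 0 < k) (hk' : k ≤ c.len x) :
    TrivialExtension.tau K _ (c.cyc (d.theta hI) x k * d.vertex w) =
      if w = c.src x ∧ k = c.len x then 1 else 0 := by
  by_cases h : c.src (c.next^[k] x) = w
  · rw [← h, d.cyc_mul_vertex_src hI x k hk, d.tau_cyc hI x k hk']
    refine if_congr ⟨fun h' => ⟨?_, h'⟩, And.right⟩ rfl rfl
    rw [h', c.iterate_len]
  · rw [d.cyc_mul_vertex hI w x k hk h, map_zero, if_neg]
    rintro ⟨h1, h2⟩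
    rw [h2, c.iterate_len] at h
    exact h h1.symm

theorem tau_vertex_mul_vertex (w w' : W) :
    TrivialExtension.tau K _ (d.vertex w * d.vertex w') = 0 := by
  rw [vertex, vertex, ← inl_mul, TrivialExtension.tau_inl]

/-- The interval coefficients embed the algebra in a finite-dimensional coordinate space. The
transpose of an injective map is surjective, so the coordinate functionals span the dual;
repetitions at length zero do no harm. -/
theorem span_dual [Finite E] : Submodule.span K
    (Set.range fun i : Σ y : E, Fin (d.depth y + 1) => d.dual hI i.1 i.2) = ⊤ := by
  classical
  have := Fintype.ofFinite E
  let f (i : Σ y : E, Fin (d.depth y + 1)) : Module.Dual K (QuiverAlgebra I) := d.dual hI i.1 i.2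
  let ev : QuiverAlgebra I →ₗ[K] ((Σ y : E, Fin (d.depth y + 1)) → K) := LinearMap.pi f
  have hev : Function.Injective ev := by
    rw [injective_iff_map_eq_zero]
    intro x hx
    refine d.eq_zero_of_dual_eq_zero hI x fun y k hk => ?_
    exact congrFun hx ⟨y, ⟨k, Nat.lt_succ_of_le hk⟩⟩
  rw [eq_top_iff]
  rintro g -
  obtain ⟨h, rfl⟩ := LinearMap.dualMap_surjective_of_injective hev g
  have hg : (ev.dualMap h : Module.Dual K (QuiverAlgebra I)) = ∑ i, h (Pi.single i 1) • f i := by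
    refine LinearMap.ext fun x => ?_
    rw [LinearMap.dualMap_apply, LinearMap.sum_apply]
    conv_lhs => rw [pi_eq_sum_univ' (ev x), map_sum]
    refine Finset.sum_congr rfl fun i _ => ?_
    rw [map_smul, LinearMap.smul_apply, smul_eq_mul, smul_eq_mul, mul_comm]
    congr 2
  have hmem : ∑ i, h (Pi.single i 1) • d.dual hI i.1 i.2 ∈ Submodule.span K
      (Set.range fun i : Σ y : E, Fin (d.depth y + 1) => d.dual hI i.1 i.2) :=
    Submodule.sum_mem _ fun i _ => Submodule.smul_mem _ _ (Submodule.subset_span ⟨i, rfl⟩)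
  exact (congrArg (· ∈ Submodule.span K (Set.range fun i : Σ y : E, Fin (d.depth y + 1) =>
    d.dual hI i.1 i.2)) hg).mpr hmem

variable (c) in
/-- The index of an arrow of a cyclic quiver. -/
noncomputable def _root_.CyclicQuiver.index {a b : W} (x : a ⟶ b) : E :=
  (c.hom_bijective.2 ⟨a, b, x⟩).choose

theorem _root_.CyclicQuiver.index_hom (x : E) : c.index (c.hom x) = x :=
  c.hom_bijective.1 (c.hom_bijective.2 ⟨_, _, c.hom x⟩).choose_spec

variable [Fintype W]

/-- The homomorphism from the path algebra of the cyclic quiver to the trivial extension. -/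
noncomputable def pathHom : PathAlgebra K W →ₐ[K] TrivialExtension K (QuiverAlgebra I) :=
  liftAlg d.vertex (fun _ _ x => d.theta hI (c.index x)) d.vertex_mul_vertex
    d.vertex_mul_vertex_of_ne d.sum_vertex (fun a b x => by
      obtain ⟨z, hz⟩ := c.hom_bijective.2 ⟨a, b, x⟩
      cases hz
      rw [index_hom, theta_mul_vertex])

theorem pathHom_arrowElt (x : E) : d.pathHom hI (c.arrowElt K x) = d.theta hI x := by
  rw [pathHom, arrowElt, liftAlg_ofArrow, index_hom]
  rw [index_hom, vertex_mul_theta]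

theorem pathHom_vertexIdem (w : W) : d.pathHom hI (vertexIdem K w) = d.vertex w := by
  rw [pathHom, vertexIdem, liftAlg_ofPath]
  rfl

theorem pathHom_cyc (x : E) (k : ℕ) :
    d.pathHom hI (c.cyc (c.arrowElt K) x k) = c.cyc (d.theta hI) x k := by
  refine (c.map_cyc _ (d.pathHom hI).toRingHom x k).trans ?_
  congr 1
  exact funext (d.pathHom_arrowElt hI)

theorem pathHom_eq_zero (x : PathAlgebra K W) (hx : x ∈ c.ideal K) : d.pathHom hI x = 0 := by
  have h : c.ideal K ≤ TwoSidedIdeal.ker (d.pathHom hI) := by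
    rw [ideal, TwoSidedIdeal.span_le]
    rintro r ((⟨x, y, hxy, rfl⟩ | ⟨x, rfl⟩) | ⟨x, y, hxy, rfl⟩) <;>
      rw [SetLike.mem_coe, TwoSidedIdeal.mem_ker]
    · rw [map_sub, pathHom_cyc, pathHom_cyc, cyc_theta_len, cyc_theta_len,
        d.dual_zero_eq hI hxy, sub_self]
    · rw [map_mul, pathHom_cyc, pathHom_arrowElt, cyc_theta_len_mul]
    · rw [map_mul, pathHom_arrowElt, pathHom_arrowElt, d.theta_mul_of_ne hI x y hxy]
  exact TwoSidedIdeal.mem_ker _ |>.1 (h hx)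

/-- The homomorphism from the algebra of the cyclic quiver to the trivial extension. -/
noncomputable def algHom :
    QuiverAlgebra (c.ideal K) →ₐ[K] TrivialExtension K (QuiverAlgebra I) :=
  (c.ideal K).ringCon.liftₐ (d.pathHom hI) fun x y hxy => by
    change d.pathHom hI x = d.pathHom hI y
    rw [← sub_eq_zero, ← map_sub]
    exact d.pathHom_eq_zero hI _ ((TwoSidedIdeal.rel_iff _ x y).1 hxy)

theorem algHom_mk (x : PathAlgebra K W) :
    d.algHom hI ((c.ideal K).ringCon.mkₐ K x) = d.pathHom hI x := rfl

theorem algHom_cyc (x : E) (k : ℕ) :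
    d.algHom hI (c.cyc (c.arrowClass K) x k) = c.cyc (d.theta hI) x k := by
  rw [← mk_cyc, algHom_mk, pathHom_cyc]

theorem inl_mem_range (b : QuiverAlgebra I) : inl b ∈ (d.algHom hI).range := by
  obtain ⟨b, rfl⟩ := I.ringCon.mkₐ_surjective (α := K) b
  let φ := (inlAlgHom K (QuiverAlgebra I) (DualBimodule K (QuiverAlgebra I))).comp
    (I.ringCon.mkₐ K)
  change φ b ∈ (d.algHom hI).range
  induction b using PathAlgebra.induction_on with
  | zero => rw [map_zero]; exact zero_mem _
  | add x y hx hy => rw [map_add]; exact add_mem hx hy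
  | smul k a b p =>
    rw [map_smul]
    refine Subalgebra.smul_mem _ ?_ k
    induction p with
    | nil =>
      obtain ⟨w, rfl⟩ := d.vtx.surjective a
      exact ⟨(c.ideal K).ringCon.mkₐ K (vertexIdem K w), d.pathHom_vertexIdem hI w⟩
    | @cons v w p x ih =>
      rw [ofPath_cons, map_mul]
      refine mul_mem ih ⟨(c.ideal K).ringCon.mkₐ K (c.arrowElt K (d.pos ⟨v, w, x⟩)), ?_⟩
      exact (d.pathHom_arrowElt hI _).trans (d.theta_pos hI _)

theorem dual_mem_range (y : E) (k : ℕ) (hk : k ≤ d.depth y) :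
    inr (d.dual hI y k) ∈ (d.algHom hI).range := by
  have h1 := d.depth_lt y
  -- The preimage is the complement of the interval in its cycle.
  refine ⟨c.cyc (c.arrowClass K) (c.next^[k] y) (c.len y - k), (d.algHom_cyc hI _ _).trans ?_⟩
  rw [d.cyc_theta_of_lt hI, ← Function.iterate_add_apply, c.len_iterate,
    Nat.sub_add_cancel (by omega), c.iterate_len]
  · congr 2
    omega
  · rw [d.depth_iterate _ _ hk]
    omega
  · rw [c.len_iterate]
    omega

theorem algHom_surjective [Finite E] : Function.Surjective (d.algHom hI) := by
  have h : ∀ f, inr f ∈ (d.algHom hI).range := by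
    intro f
    have hf : f ∈ Submodule.span K
        (Set.range fun i : Σ y : E, Fin (d.depth y + 1) => d.dual hI i.1 i.2) := by
      rw [span_dual]; trivial
    induction hf using Submodule.span_induction with
    | mem x hx =>
      obtain ⟨i, rfl⟩ := hx
      exact d.dual_mem_range hI _ _ (Nat.le_of_lt_succ i.2.2)
    | zero => rw [inr_zero]; exact zero_mem _
    | add x y _ _ hx hy => rw [inr_add]; exact add_mem hx hy
    | smul k x _ hx => rw [inr_smul]; exact Subalgebra.smul_mem _ hx k
  intro x
  have : x ∈ (d.algHom hI).range := by
    rw [← inl_fst_add_inr_snd_eq x]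
    exact add_mem (d.inl_mem_range hI _) (h _)
  exact this

/-! ## Injectivity -/

variable (c K) in
/-- A spanning family of the algebra of a cyclic quiver: trivial paths, full cycles, and proper
intervals of cycles. -/
noncomputable def _root_.CyclicQuiver.family :
    (W ⊕ W) ⊕ (Σ x : E, Fin (c.len x - 1)) → QuiverAlgebra (c.ideal K)
  | .inl (.inl w) => (c.ideal K).ringCon.mkₐ K (vertexIdem K w)
  | .inl (.inr w) => c.cyc (c.arrowClass K) (c.src_surjective w).choose
      (c.len (c.src_surjective w).choose)
  | .inr ⟨x, k⟩ => c.cyc (c.arrowClass K) x (k + 1)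

-- By `mk_ofPath` only trivial paths and intervals remain, and full cycles at the same vertex agree,
-- so one of them per vertex suffices.
variable (c K) in
theorem _root_.CyclicQuiver.span_family : Submodule.span K (Set.range (c.family K)) = ⊤ := by
  rw [eq_top_iff]
  rintro x -
  obtain ⟨x, rfl⟩ := (c.ideal K).ringCon.mkₐ_surjective (α := K) x
  induction x using PathAlgebra.induction_on with
  | zero => rw [map_zero]; exact zero_mem _
  | add x y hx hy => rw [map_add]; exact add_mem hx hy
  | smul k a b p =>
    rw [map_smul]
    refine Submodule.smul_mem _ _ ?_
    obtain h | ⟨-, h⟩ | ⟨x, h0, h1, h⟩ := c.mk_ofPath K p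
    · rw [h]; exact zero_mem _
    · rw [h]
      exact Submodule.subset_span ⟨.inl (.inl b), rfl⟩
    · rw [h]
      obtain h1 | h1 := h1.lt_or_eq
      · refine Submodule.subset_span ⟨.inr ⟨x, ⟨p.length - 1, by omega⟩⟩, ?_⟩
        change c.cyc (c.arrowClass K) x (p.length - 1 + 1) = _
        rw [Nat.sub_add_cancel h0]
      · refine Submodule.subset_span ⟨.inl (.inr (c.src x)), ?_⟩
        rw [h1]
        exact c.cyc_arrowClass_eq K (c.src_surjective (c.src x)).choose_spec

variable (c K) in
/-- The family dual to the spanning family with respect to the symmetrizing form. -/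
noncomputable def _root_.CyclicQuiver.dualFamily :
    (W ⊕ W) ⊕ (Σ x : E, Fin (c.len x - 1)) → QuiverAlgebra (c.ideal K)
  | .inl (.inl w) => c.family K (.inl (.inr w))
  | .inl (.inr w) => c.family K (.inl (.inl w))
  | .inr ⟨x, k⟩ => c.cyc (c.arrowClass K) (c.next^[k + 1] x) (c.len x - (k + 1))

-- Complementary intervals multiply to a full cycle, and trivial paths are paired with full cycles.
-- Since `tau` sees only full cycles, the pairing matrix is the identity; applied to a relation in
-- the kernel it isolates each coefficient.
open Classical in
theorem tau_family_mul_dualFamily (i j : (W ⊕ W) ⊕ (Σ x : E, Fin (c.len x - 1))) :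
    TrivialExtension.tau K _ (d.algHom hI (c.family K i * c.dualFamily K j)) =
      if i = j then 1 else 0 := by
  have hlen := c.len_pos
  have hrep : ∀ w, c.src (c.src_surjective w).choose = w := fun w =>
    (c.src_surjective w).choose_spec
  rw [map_mul]
  obtain (v | v) | ⟨x, k, hk⟩ := i <;> obtain (w | w) | ⟨y, l, hl⟩ := j <;>
    simp only [family, dualFamily, algHom_cyc, algHom_mk, pathHom_vertexIdem]
  · rw [d.tau_vertex_mul_cyc hI _ _ _ (hlen _) le_rfl, hrep]
    simp
  · rw [tau_vertex_mul_vertex]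
    simp
  · rw [d.tau_vertex_mul_cyc hI _ _ _ (by omega) (by rw [c.len_iterate]; omega), c.len_iterate,
      if_neg (by have := hlen y; omega)]
    simp
  · rw [d.tau_cyc_mul_cyc hI _ _ _ _ (hlen _) (hlen _), if_neg]
    · simp
    · have := hlen (c.src_surjective w).choose
      omega
  · rw [d.tau_cyc_mul_vertex hI _ _ _ (hlen _) le_rfl, hrep]
    simp [eq_comm]
  · rw [d.tau_cyc_mul_cyc hI _ _ _ _ (hlen _) (by omega), if_neg]
    · simp
    · omega
  · rw [d.tau_cyc_mul_cyc hI _ _ _ _ (by omega) (hlen _), if_neg]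
    · simp
    · rintro ⟨h1, h2⟩
      rw [h1, c.len_iterate] at h2
      omega
  · rw [d.tau_cyc_mul_vertex hI _ _ _ (by omega) (by omega), if_neg]
    · simp
    · omega
  · rw [d.tau_cyc_mul_cyc hI _ _ _ _ (by omega) (by omega)]
    refine if_congr ?_ rfl rfl
    rw [Sum.inr.injEq]
    constructor
    · rintro ⟨h1, h2⟩
      have h3 : c.len y = c.len x := by
        rw [← c.len_iterate y (l + 1), h1, c.len_iterate]
      have h4 : l = k := by omega
      subst h4
      have h5 : y = x := (c.next_injective.iterate (l + 1)) h1
      subst h5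
      rfl
    · intro h
      cases h
      exact ⟨rfl, by omega⟩

theorem algHom_injective [Finite E] : Function.Injective (d.algHom hI) := by
  classical
  have := Fintype.ofFinite E
  rw [injective_iff_map_eq_zero]
  intro x hx
  have hmem : x ∈ Submodule.span K (Set.range (c.family K)) := by
    rw [span_family]; trivial
  obtain ⟨a, rfl⟩ := (Submodule.mem_span_range_iff_exists_fun K).1 hmem
  have ha : ∀ j, a j = 0 := by
    intro j
    have h : TrivialExtension.tau K _ (d.algHom hI ((∑ i, a i • c.family K i) *
        c.dualFamily K j)) = 0 := by
      rw [map_mul, hx, zero_mul, map_zero]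
    rw [Finset.sum_mul, map_sum, map_sum, Finset.sum_eq_single j] at h
    · rw [smul_mul_assoc, map_smul, map_smul, d.tau_family_mul_dualFamily hI, if_pos rfl,
        smul_eq_mul, mul_one] at h
      exact h
    · intro i _ hij
      rw [smul_mul_assoc, map_smul, map_smul, d.tau_family_mul_dualFamily hI, if_neg hij,
        smul_zero]
    · simp
  simp [ha]

/-- The trivial extension of a quadratic monomial algebra whose nonzero paths are intervals of the
cycles of a cyclic quiver is the algebra of the cyclic quiver. -/
noncomputable def algEquiv [Finite E] :
    TrivialExtension K (QuiverAlgebra I) ≃ₐ[K] QuiverAlgebra (c.ideal K) :=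
  (AlgEquiv.ofBijective (d.algHom hI) ⟨d.algHom_injective hI, d.algHom_surjective hI⟩).symm

end CyclicQuiver.Cut

open PathAlgebra

/-! # Chains of a relation -/

section Chains

variable {X : Type u} (R : X → X → Prop)

open Classical in
/-- The successor of an element, or the element itself if it has no successor. -/
noncomputable def chainNext (x : X) : X := if h : ∃ y, R x y then h.choose else x

variable {R}

theorem rel_chainNext {x : X} (h : ∃ y, R x y) : R x (chainNext R x) := by
  rw [chainNext, dif_pos h]
  exact h.choose_spec

/-- If successors never ran out, the first `N` iterates would form a chain of length `N`. -/
theorem exists_not_rel_iterate {N : ℕ} (hN : ∀ l : List X, l.IsChain R → l.length < N) (x : X) :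
    ∃ k, ¬ ∃ y, R ((chainNext R)^[k] x) y := by
  by_contra! h
  have key : ∀ n x, (∀ k, ∃ y, R ((chainNext R)^[k] x) y) →
      (List.iterate (chainNext R) x n).IsChain R := by
    intro n
    induction n with
    | zero => intro x _; exact List.isChain_nil
    | succ n ih =>
      intro x hx
      cases n with
      | zero => exact List.isChain_singleton _
      | succ n => exact List.isChain_cons_cons.2 ⟨rel_chainNext (hx 0), ih _ fun k => hx (k + 1)⟩
  have := hN _ (key N x h)
  rw [List.length_iterate] at this
  exact lt_irrefl _ this

variable {N : ℕ} (hN : ∀ l : List X, l.IsChain R → l.length < N)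

open Classical in
/-- The number of elements of the chain that starts with an element. -/
noncomputable def chainLen (x : X) : ℕ := Nat.find (exists_not_rel_iterate hN x) + 1

theorem exists_rel_iff (x : X) {i : ℕ} (hi : i < chainLen hN x) :
    (∃ y, R ((chainNext R)^[i] x) y) ↔ i + 1 < chainLen hN x := by
  classical
  constructor
  · intro h
    by_contra hlt
    have : i = Nat.find (exists_not_rel_iterate hN x) := by
      rw [chainLen] at hi hlt
      omega
    exact Nat.find_spec (exists_not_rel_iterate hN x) (this ▸ h)
  · intro h
    rw [chainLen] at h
    exact not_not.1 (Nat.find_min (exists_not_rel_iterate hN x) (m := i) (by omega))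

theorem rel_iterate (x : X) {i : ℕ} (hi : i + 1 < chainLen hN x) :
    R ((chainNext R)^[i] x) ((chainNext R)^[i + 1] x) := by
  rw [Function.iterate_succ_apply']
  exact rel_chainNext ((exists_rel_iff hN x (by omega)).2 hi)

/-- Predecessors are unique, so both chains can be followed backwards from the common element. Their
starts have no predecessor, so they are reached at the same moment. -/
theorem chain_injective (hinj : ∀ x y z, R x z → R y z → x = y) {x y : X}
    (hx : ∀ z, ¬ R z x) (hy : ∀ z, ¬ R z y) {i j : ℕ} (hi : i < chainLen hN x)
    (hj : j < chainLen hN y) (h : (chainNext R)^[i] x = (chainNext R)^[j] y) : x = y ∧ i = j := by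
  induction i generalizing j with
  | zero =>
    cases j with
    | zero => exact ⟨h, rfl⟩
    | succ j =>
      have := rel_iterate hN y hj
      rw [← h] at this
      exact absurd this (hx _)
  | succ i ih =>
    have h1 := rel_iterate hN x hi
    cases j with
    | zero =>
      rw [h] at h1
      exact absurd h1 (hy _)
    | succ j =>
      have h2 := rel_iterate hN y hj
      rw [h] at h1
      obtain ⟨h3, h4⟩ := ih (by omega) (by omega) (hinj _ _ _ h1 h2)
      exact ⟨h3, by rw [h4]⟩

/-- Going backwards from `x` either reaches an element without predecessor or yields chains of every
length ending at `x`, against `hN`. Uniqueness of successors ensures that the iterates of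
`chainNext` retrace the same steps. -/
theorem chain_surjective (hfun : ∀ x y z, R x y → R x z → y = z) (x : X) :
    ∃ y i, (∀ z, ¬ R z y) ∧ i < chainLen hN y ∧ (chainNext R)^[i] y = x := by
  have key : ∀ k x, (∃ y i, (∀ z, ¬ R z y) ∧ i < chainLen hN y ∧ (chainNext R)^[i] y = x) ∨
      ∃ l : List X, l.length = k ∧ (l ++ [x]).IsChain R := by
    intro k
    induction k with
    | zero => exact fun x => Or.inr ⟨[], rfl, List.isChain_singleton _⟩
    | succ k ih =>
      intro x
      by_cases hx : ∃ z, R z x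
      · obtain ⟨z, hz⟩ := hx
        obtain ⟨y, i, hy, hi, hzy⟩ | ⟨l, hl, hlz⟩ := ih z
        · left
          have h1 := (exists_rel_iff hN y hi).1 ⟨x, hzy ▸ hz⟩
          have h2 := rel_iterate hN y h1
          rw [hzy] at h2
          exact ⟨y, i + 1, hy, h1, hfun _ _ _ h2 hz⟩
        · right
          refine ⟨l ++ [z], by simp [hl], ?_⟩
          rw [List.isChain_append]
          refine ⟨hlz, List.isChain_singleton _, ?_⟩
          simpa using hz
      · left
        push Not at hx
        exact ⟨x, 0, hx, Nat.succ_pos _, rfl⟩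
  obtain h | ⟨l, hl, hlx⟩ := key N x
  · exact h
  · have := hN _ hlx
    rw [List.length_append, hl] at this
    omega

end Chains

/-! # The cycles of an almost gentle presentation -/

section Rotation

/-- The cyclic successor in a disjoint union of cycles. -/
def cycleNext {M : Type u} {L : M → ℕ} (x : Σ m, Fin (L m)) : Σ m, Fin (L m) :=
  ⟨x.1, finRotate _ x.2⟩

theorem val_finRotate {n : ℕ} (i : Fin n) : (finRotate n i : ℕ) = (i + 1) % n := by
  cases n with
  | zero => exact i.elim0
  | succ n => rw [finRotate_apply, Fin.val_add, Fin.val_one', Nat.add_mod_mod]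

theorem val_iterate_finRotate {n : ℕ} (i : Fin n) (k : ℕ) :
    ((finRotate n)^[k] i : ℕ) = (i + k) % n := by
  induction k with
  | zero => exact (Nat.mod_eq_of_lt i.2).symm
  | succ k ih => rw [Function.iterate_succ_apply', val_finRotate, ih, Nat.mod_add_mod, add_assoc]

theorem iterate_cycleNext {M : Type u} {L : M → ℕ} (x : Σ m, Fin (L m)) :
    cycleNext^[L x.1] x = x := by
  have h : ∀ k, cycleNext^[k] x = ⟨x.1, (finRotate _)^[k] x.2⟩ := by
    intro k
    induction k with
    | zero => rfl
    | succ k ih => rw [Function.iterate_succ_apply', ih, Function.iterate_succ_apply']; rfl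
  rw [h]
  refine Sigma.ext rfl (heq_of_eq (Fin.ext ?_))
  rw [val_iterate_finRotate, Nat.add_mod_right, Nat.mod_eq_of_lt x.2.2]

end Rotation

/-- The maximal paths of a quiver with relations, including the trivial paths at isolated vertices.
The places of a maximal path are its vertices; all of them but the last one are identified with
the arrows that start there. -/
structure ChainData {K : Type u} [Field K] {V : Type u} [Quiver.{u} V] [Fintype V]
    (I : TwoSidedIdeal (PathAlgebra K V)) where
  /-- the maximal paths -/
  Chain : Type u
  [fintypeChain : Fintype Chain]
  /-- the length of a maximal path -/
  len : Chain → ℕ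
  /-- the vertex at a place of a maximal path -/
  vtx : (Σ m, Fin (len m + 1)) → V
  vtx_surjective : Function.Surjective vtx
  /-- the place at which an arrow starts -/
  pos : Arr V → Σ m, Fin (len m + 1)
  pos_injective : Function.Injective pos
  pos_lt : ∀ a, ((pos a).2 : ℕ) < len (pos a).1
  exists_pos : ∀ x : Σ m, Fin (len m + 1), (x.2 : ℕ) < len x.1 → ∃ a, pos a = x
  vtx_src : ∀ a, vtx (pos a) = a.1
  vtx_tgt : ∀ a, vtx (cycleNext (pos a)) = a.2.1
  pos_eq_iff : ∀ a b, pos b = cycleNext (pos a) ↔ Follows I a b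
  eq_of_len_eq_zero : ∀ x y, len x.1 = 0 → vtx x = vtx y → x = y
  isEmpty_of_len_eq_zero : ∀ x, len x.1 = 0 → ∀ w, IsEmpty (vtx x ⟶ w) ∧ IsEmpty (w ⟶ vtx x)

section Construction

variable {K : Type u} [Field K] {V : Type u} [Quiver.{u} V] [Fintype V]
  {I : TwoSidedIdeal (PathAlgebra K V)}

theorem PathAlgebra.exists_path_of_isChain (l : List (Arr V)) (hl : l ≠ [])
    (h : l.IsChain (Follows I)) : ∃ (a b : V) (p : Quiver.Path a b), arrows p = l := by
  have key : ∀ (l : List (Arr V)) (x : Arr V), (l ++ [x]).IsChain (Follows I) →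
      ∃ (a : V) (p : Quiver.Path a x.2.1), arrows p = l ++ [x] := by
    intro l
    induction l using List.reverseRecOn with
    | nil =>
      rintro ⟨s, t, x⟩ _
      exact ⟨s, x.toPath, rfl⟩
    | append_singleton l y ih =>
      rintro ⟨s, t, x⟩ hx
      rw [List.isChain_append] at hx
      obtain ⟨a, p, hp⟩ := ih y hx.1
      have hyx : Follows I y ⟨s, t, x⟩ := hx.2.2 y (by simp) _ (by simp)
      obtain ⟨s', t', y⟩ := y
      obtain rfl : t' = s := hyx.tgt_eq
      exact ⟨a, p.cons x, by rw [arrows_cons, hp]⟩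
  obtain ⟨l, x, rfl⟩ := List.eq_nil_or_concat l |>.resolve_left hl
  rw [List.concat_eq_append] at h ⊢
  obtain ⟨a, p, hp⟩ := key l x h
  exact ⟨a, _, p, hp⟩

/-- A chain of arrows is a path outside `I`, whereas admissibility puts all long paths into `I`.
Hence maximal paths exist and no chain runs in a circle. -/
theorem IsAlmostGentleIdeal.exists_bound (hI : IsAlmostGentleIdeal I) :
    ∃ N, ∀ l : List (Arr V), l.IsChain (Follows I) → l.length < N := by
  obtain ⟨N, hN2, hN⟩ := hI.admissible.2
  refine ⟨N, fun l hl => ?_⟩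
  by_contra! h
  have hne : l ≠ [] := by
    rintro rfl
    simp at h
    omega
  obtain ⟨a, b, p, rfl⟩ := exists_path_of_isChain l hne hl
  rw [length_arrows] at h
  exact ofPath_notMem_of_isChain hI.quadratic p hl
    (hN (TwoSidedIdeal.subset_span ⟨a, b, p, h, rfl⟩))

theorem IsAlmostGentleIdeal.follows_unique (hI : IsAlmostGentleIdeal I) (a b b' : Arr V)
    (h : Follows I a b) (h' : Follows I a b') : b = b' := by
  obtain ⟨v, w, a⟩ := a
  obtain ⟨s, t, b⟩ := b
  obtain ⟨s', t', b'⟩ := b'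
  obtain rfl : w = s := h.tgt_eq
  obtain rfl : w = s' := h'.tgt_eq
  cases (hI.multiserial v w a).1 ⟨t, b⟩ ⟨t', b'⟩ h h'
  rfl

theorem IsAlmostGentleIdeal.unique_follows (hI : IsAlmostGentleIdeal I) (b b' a : Arr V)
    (h : Follows I b a) (h' : Follows I b' a) : b = b' := by
  obtain ⟨v, w, a⟩ := a
  obtain ⟨s, t, b⟩ := b
  obtain ⟨s', t', b'⟩ := b'
  obtain rfl : t = v := h.tgt_eq
  obtain rfl : t' = t := h'.tgt_eq
  cases (hI.multiserial t' w a).2 ⟨s, b⟩ ⟨s', b'⟩ h h'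
  rfl

theorem IsAlmostGentleIdeal.finite_arr (hI : IsAlmostGentleIdeal I) : Finite (Arr V) := by
  have := hI.finite_arrows
  infer_instance

theorem IsAlmostGentleIdeal.nonempty_chainData (hI : IsAlmostGentleIdeal I) :
    Nonempty (ChainData I) := by
  classical
  obtain ⟨N, hN⟩ := hI.exists_bound
  have := hI.finite_arr
  let g := chainNext (Follows I)
  -- A maximal path of positive length is indexed by its first arrow, an arrow without predecessor;
  -- the trivial ones are indexed by the isolated vertices.
  let M₁ := {m : Arr V // ∀ z, ¬ Follows I z m}
  let M₂ := {v : V // ∀ w, IsEmpty (v ⟶ w) ∧ IsEmpty (w ⟶ v)}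
  have : Fintype (M₁ ⊕ M₂) := Fintype.ofFinite _
  let len : M₁ ⊕ M₂ → ℕ := Sum.elim (fun m => chainLen hN m.1) 0
  have hlen : ∀ m : M₁, 0 < chainLen hN m.1 := fun m => Nat.succ_pos _
  -- A path with `n` arrows has `n + 1` places. Place `i + 1` is the target of arrow `i`, which
  -- makes sense for the last place too; by `hsrc` each earlier place is the source of its arrow.
  let vtxNat : M₁ ⊕ M₂ → ℕ → V := fun m i => match m, i with
    | .inl m, 0 => m.1.1
    | .inl m, i + 1 => (g^[i] m.1).2.1
    | .inr v, _ => v.1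
  let vtx : (Σ m, Fin (len m + 1)) → V := fun x => vtxNat x.1 x.2
  have hsrc : ∀ (m : M₁) (i : ℕ), i < chainLen hN m.1 → vtxNat (.inl m) i = (g^[i] m.1).1 := by
    intro m i hi
    cases i with
    | zero => rfl
    | succ i => exact (rel_iterate hN m.1 hi).tgt_eq
  have hex : ∀ a : Arr V, ∃ (m : M₁) (i : ℕ), i < chainLen hN m.1 ∧ g^[i] m.1 = a := by
    intro a
    obtain ⟨y, i, hy, hi, h⟩ := chain_surjective hN hI.follows_unique a
    exact ⟨⟨y, hy⟩, i, hi, h⟩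
  choose μ ι hι hμ using hex
  have huniq : ∀ (m : M₁) (i : ℕ), i < chainLen hN m.1 → μ (g^[i] m.1) = m ∧ ι (g^[i] m.1) = i := by
    intro m i hi
    obtain ⟨h1, h2⟩ := chain_injective hN hI.unique_follows (μ (g^[i] m.1)).2 m.2 (hι _) hi (hμ _)
    exact ⟨Subtype.ext h1, h2⟩
  let pos : Arr V → Σ m, Fin (len m + 1) := fun a => ⟨.inl (μ a), ⟨ι a, Nat.lt_succ_of_lt (hι a)⟩⟩
  have hpos : ∀ (m : M₁) (i : ℕ) (hi : i < chainLen hN m.1),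
      pos (g^[i] m.1) = ⟨.inl m, ⟨i, Nat.lt_succ_of_lt hi⟩⟩ := by
    intro m i hi
    obtain ⟨h1, h2⟩ := huniq m i hi
    simp only [pos]
    generalize g^[i] m.1 = a at h1 h2
    subst h1 h2
    rfl
  -- No arrow starts at the last place, so the rotation does not wrap around here.
  have hnext : ∀ a, cycleNext (pos a) = (⟨.inl (μ a), ⟨ι a + 1, Nat.succ_lt_succ (hι a)⟩⟩ :
      Σ m, Fin (len m + 1)) := by
    intro a
    refine Sigma.ext rfl (heq_of_eq (Fin.ext ?_))
    refine (val_finRotate _).trans (Nat.mod_eq_of_lt ?_)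
    exact Nat.succ_lt_succ (hι a)
  refine ⟨{
    Chain := M₁ ⊕ M₂
    len := len
    vtx := vtx
    vtx_surjective := ?_
    pos := pos
    pos_injective := ?_
    pos_lt := fun a => hι a
    exists_pos := ?_
    vtx_src := fun a => (hsrc _ _ (hι a)).trans (congrArg Sigma.fst (hμ a))
    vtx_tgt := ?_
    pos_eq_iff := ?_
    eq_of_len_eq_zero := ?_
    isEmpty_of_len_eq_zero := ?_ }⟩
  · intro v
    by_cases h : ∀ w, IsEmpty (v ⟶ w) ∧ IsEmpty (w ⟶ v)
    · exact ⟨⟨.inr ⟨v, h⟩, 0⟩, rfl⟩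
    · push Not at h
      obtain ⟨w, h⟩ := h
      by_cases h1 : IsEmpty (v ⟶ w)
      · obtain ⟨x⟩ := h h1
        refine ⟨cycleNext (pos ⟨w, v, x⟩), ?_⟩
        rw [hnext]
        change (g^[ι ⟨w, v, x⟩] (μ ⟨w, v, x⟩).1).2.1 = v
        rw [hμ]
      · obtain ⟨x⟩ := not_isEmpty_iff.1 h1
        exact ⟨pos ⟨v, w, x⟩, (hsrc _ _ (hι _)).trans (congrArg Sigma.fst (hμ _))⟩
  · intro a b h
    rw [← hμ a, ← hμ b]
    simp only [pos, Sigma.mk.injEq, Sum.inl.injEq] at h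
    obtain ⟨h1, h2⟩ := h
    have h3 : ι a = ι b := by
      have h4 : len (.inl (μ a)) = len (.inl (μ b)) := by rw [h1]
      have := (Fin.heq_ext_iff (by rw [h4])).1 h2
      exact this
    rw [h1, h3]
  · rintro ⟨m | v, i⟩ hi
    · exact ⟨g^[(i : ℕ)] m.1, hpos m i hi⟩
    · exact absurd hi (Nat.not_lt_zero _)
  · intro a
    rw [hnext]
    change (g^[ι a] (μ a).1).2.1 = a.2.1
    rw [hμ]
  · intro a b
    rw [hnext]
    constructor
    · intro h
      have hb := hι b
      have h1 : μ b = μ a := Sum.inl_injective (congrArg Sigma.fst h)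
      have h2 : ι b = ι a + 1 := by
        have := congrArg (fun x : Σ m, Fin (len m + 1) => (x.2 : ℕ)) h
        exact this
      rw [h1, h2] at hb
      have h3 := rel_iterate hN (μ a).1 hb
      have h4 := hμ b
      rw [h1, h2] at h4
      change Follows I (g^[ι a] (μ a).1) (g^[ι a + 1] (μ a).1) at h3
      rwa [hμ, h4] at h3
    · intro h
      have h1 : ι a + 1 < chainLen hN (μ a).1 := by
        rw [← exists_rel_iff hN _ (hι a)]
        refine ⟨b, ?_⟩
        change Follows I (g^[ι a] (μ a).1) b
        rwa [hμ]
      have h2 := rel_iterate hN (μ a).1 h1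
      change Follows I (g^[ι a] (μ a).1) (g^[ι a + 1] (μ a).1) at h2
      rw [hμ] at h2
      rw [hI.follows_unique _ _ _ h h2, hpos _ _ h1]
  · rintro ⟨m | v, i⟩ ⟨m' | v', j⟩ hx hxy
    · exact absurd hx (hlen m).ne'
    · exact absurd hx (hlen m).ne'
    -- Every place of a nontrivial path touches an arrow, so its vertex is not isolated.
    · exfalso
      obtain ⟨j, hj⟩ := j
      change v.1 = vtxNat (.inl m') j at hxy
      cases j with
      | zero => exact (v.2 m'.1.2.1).1.elim (hxy ▸ m'.1.2.2)
      | succ j => exact (v.2 (g^[j] m'.1).1).2.elim (hxy ▸ (g^[j] m'.1).2.2)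
    · have : v = v' := Subtype.ext hxy
      subst this
      refine Sigma.ext rfl (heq_of_eq ?_)
      exact Subsingleton.elim (α := Fin 1) i j
  · rintro ⟨m | v, i⟩ hx
    · exact absurd hx (hlen m).ne'
    · exact v.2

end Construction

open PathAlgebra

/-! # The quiver of the maximal paths, closed up to cycles -/

namespace ChainData

variable {K : Type u} [Field K] {V : Type u} [Quiver.{u} V] [Fintype V]
  {I : TwoSidedIdeal (PathAlgebra K V)} (D : ChainData I)

attribute [instance] fintypeChain

/-- The places of the maximal paths. -/
abbrev Place : Type u := Σ m, Fin (D.len m + 1)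

/-- The vertices of the original quiver as the vertices of the quiver of the closed up paths. -/
def Vertex (_ : ChainData I) : Type u := V

instance : Fintype D.Vertex := inferInstanceAs (Fintype V)

instance : Quiver.{u} D.Vertex where
  Hom v w := {x : D.Place // D.vtx x = v ∧ D.vtx (cycleNext x) = w}

/-- The quiver whose cycles are the maximal paths, closed up by an additional arrow. -/
def cyclicQuiver : CyclicQuiver D.Vertex D.Place where
  next := cycleNext
  len x := D.len x.1 + 1
  src := D.vtx
  hom x := ⟨x, rfl, rfl⟩
  hom_bijective := by
    constructor
    · intro x y h
      exact congrArg (fun a : Arr D.Vertex => a.2.2.1) h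
    · rintro ⟨v, w, ⟨x, rfl, rfl⟩⟩
      exact ⟨x, rfl⟩
  len_pos _ := Nat.succ_pos _
  len_next _ := rfl
  iterate_len := iterate_cycleNext
  src_surjective := D.vtx_surjective

/-- A cyclic quiver with the same cycles as the closed up maximal paths can be cut. -/
def cut {W : Type u} [Quiver.{u} W] {E : Type u} (c : CyclicQuiver W E) (η : W ≃ V)
    (g : E ≃ D.Place) (hnext : ∀ x, g (c.next x) = cycleNext (g x))
    (hlen : ∀ x, c.len x = D.len (g x).1 + 1) (hsrc : ∀ x, η (c.src x) = D.vtx (g x)) :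
    c.Cut I where
  vtx := η
  -- The chosen arrow of a cycle is the one at the last place, which closes up the maximal path. The
  -- relabelling `g` allows the same cut for the quiver of a Brauer configuration.
  depth x := D.len (g x).1 - (g x).2
  depth_lt x := by rw [hlen]; omega
  depth_next x k h := by
    rw [hnext]
    change D.len (g x).1 - (finRotate _ (g x).2 : ℕ) = k
    rw [val_finRotate, Nat.mod_eq_of_lt (by omega)]
    omega
  depth_zero x h := by
    rw [hnext, hlen]
    change D.len (g x).1 - (finRotate _ (g x).2 : ℕ) + 1 = _
    have h1 := (g x).2.2
    have h2 : ((g x).2 : ℕ) + 1 = D.len (g x).1 + 1 := by omega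
    rw [val_finRotate, h2, Nat.mod_self, Nat.sub_zero]
  pos a := g.symm (D.pos a)
  pos_injective := g.symm.injective.comp D.pos_injective
  depth_pos a := by
    rw [g.apply_symm_apply]
    have := D.pos_lt a
    omega
  exists_pos x h := by
    obtain ⟨a, ha⟩ := D.exists_pos (g x) (by omega)
    exact ⟨a, by rw [ha, g.symm_apply_apply]⟩
  vtx_src a := by rw [hsrc, g.apply_symm_apply, D.vtx_src]
  vtx_tgt a := by rw [hsrc, hnext, g.apply_symm_apply, D.vtx_tgt]
  pos_eq_iff a b := by
    rw [Equiv.symm_apply_eq, hnext, g.apply_symm_apply, D.pos_eq_iff]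

end ChainData

/-- The trivial extension of an almost gentle presentation is special multiserial. -/
theorem isSpecialMultiserialAlgebra_trivialExtension {K : Type u} [Field K] {V : Type u}
    [Quiver.{u} V] [Fintype V] (I : TwoSidedIdeal (PathAlgebra K V)) (hI : IsAlmostGentleIdeal I) :
    IsSpecialMultiserialAlgebra K (TrivialExtension K (QuiverAlgebra I)) := by
  obtain ⟨D⟩ := hI.nonempty_chainData
  have := D.fintypeChain
  let c := D.cyclicQuiver
  let d : c.Cut I := D.cut c (Equiv.refl V) (Equiv.refl _) (fun _ => rfl) (fun _ => rfl)
    (fun _ => rfl)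
  -- Cycles of length one are loops at isolated vertices, and no other maximal path passes there;
  -- this is the condition for admissibility.
  refine ⟨D.Vertex, inferInstance, inferInstance, c.ideal K, c.finite_hom,
    c.isAdmissibleIdeal K fun x y hx hxy => D.eq_of_len_eq_zero x y (Nat.succ_injective hx) hxy,
    c.isSpecialMultiserialIdeal K, IsMoritaEquivalent.of_algEquiv K (d.algEquiv hI.quadratic)⟩

/-! # Brauer configurations -/

namespace BrauerConfiguration

variable (Γ : BrauerConfiguration.{u})

theorem val_eq_length (α : Γ.Vertex) : Γ.val α = (Γ.orient α).length := by
  rw [val, ← Multiset.coe_card, ← Multiset.sum_count_eq_card (s := Finset.univ) (by simp)]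
  exact Finset.sum_congr rfl fun V _ => by rw [Multiset.coe_count, Γ.count_orient]

/-- The requirement of a nontruncated vertex in every polygon says that an arrow starts at every
vertex of the quiver. -/
theorem exists_src_eq (V : Γ.Polygon) : ∃ x : Γ.Arrow, src x = V := by
  obtain ⟨α, hα, h⟩ := Γ.exists_nontruncated V
  have hV : V ∈ Γ.orient α := by
    rw [← List.count_pos_iff, Γ.count_orient]
    exact Multiset.count_pos.2 hα
  obtain ⟨i, hi⟩ := List.mem_iff_get.1 hV
  exact ⟨⟨⟨α, fun ht => h.ne' ht⟩, i⟩, hi⟩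

/-- The quiver of a Brauer configuration as a cyclic quiver. -/
def cyclicQuiver : CyclicQuiver Γ.QuiverVertex Γ.Arrow where
  next := next
  len x := (Γ.orient x.1).length
  src := src
  hom x := ⟨x, rfl, rfl⟩
  hom_bijective := by
    constructor
    · intro x y h
      exact congrArg (fun a : Arr Γ.QuiverVertex => a.2.2.1) h
    · rintro ⟨v, w, ⟨x, rfl, rfl⟩⟩
      exact ⟨x, rfl⟩
  len_pos x := x.2.pos
  len_next _ := rfl
  iterate_len := iterate_cycleNext (L := fun α : {α // ¬ Γ.IsTruncated α} => (Γ.orient α).length)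
  src_surjective := Γ.exists_src_eq

/-- With multiplicity one the powers disappear from the relations, and the two sets of generators
agree by definition. -/
theorem ideal_eq (K : Type u) [Field K] (h : ∀ α, Γ.mult α = 1) :
    Γ.ideal K = Γ.cyclicQuiver.ideal K := by
  have h1 : Γ.relationsOne K = Γ.cyclicQuiver.relationsOne K := by
    simp only [relationsOne, h, pow_one]
    rfl
  have h2 : Γ.relationsTwo K = Γ.cyclicQuiver.relationsTwo K := by
    simp only [relationsTwo, h, pow_one]
    rfl
  rw [ideal, h1, h2]
  rfl

end BrauerConfiguration

namespace ChainData

variable {K : Type u} [Field K] {V : Type u} [Quiver.{u} V] [Fintype V]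
  {I : TwoSidedIdeal (PathAlgebra K V)} (D : ChainData I)

/-- The cyclic ordering of the vertices at a maximal path, or at the additional truncated vertex
of a polygon. -/
def orient : D.Chain ⊕ V → List V
  | .inl m => List.ofFn fun i => D.vtx ⟨m, i⟩
  | .inr v => [v]

theorem length_orient_inl (m : D.Chain) : (D.orient (.inl m)).length = D.len m + 1 :=
  List.length_ofFn

open Classical in
/-- The polygon of a vertex. -/
noncomputable def polygon (v : V) : Multiset (D.Chain ⊕ V) :=
  ∑ α, Multiset.replicate ((D.orient α).count v) α

open Classical in
theorem count_polygon (v : V) (α : D.Chain ⊕ V) :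
    (D.polygon v).count α = (D.orient α).count v := by
  rw [polygon, Multiset.count_sum', Finset.sum_eq_single α]
  · rw [Multiset.count_replicate_self]
  · intro β _ hβ
    rw [Multiset.count_replicate, if_neg hβ]
  · simp

theorem exists_inl_mem_polygon (v : V) : ∃ m, .inl m ∈ D.polygon v := by
  classical
  obtain ⟨⟨m, i⟩, hx⟩ := D.vtx_surjective v
  refine ⟨m, ?_⟩
  rw [← Multiset.count_pos, count_polygon, List.count_pos_iff, orient, List.mem_ofFn]
  exact ⟨i, hx⟩

theorem inr_mem_polygon (v : V) : .inr v ∈ D.polygon v := by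
  classical
  rw [← Multiset.count_pos, count_polygon, List.count_pos_iff, orient]
  exact List.mem_singleton_self v

open Classical in
theorem sum_count_polygon (α : D.Chain ⊕ V) :
    ∑ v, (D.polygon v).count α = (D.orient α).length := by
  rw [← Multiset.coe_card, ← Multiset.sum_count_eq_card (s := Finset.univ) (by simp)]
  exact Finset.sum_congr rfl fun V _ => by rw [Multiset.coe_count, count_polygon]

open Classical in
/-- The Brauer configuration of a quiver with relations without isolated vertices. -/
noncomputable def brauer (hD : ∀ m, 0 < D.len m) : BrauerConfiguration.{u} where
  -- A vertex of the quiver may occur only once on the maximal paths. The additional vertex `inr v`,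
  -- of valency one, brings its polygon to two entries; being truncated, it contributes no arrow.
  Vertex := D.Chain ⊕ V
  Polygon := V
  poly := D.polygon
  mult _ := 1
  mult_pos _ := one_pos
  orient := D.orient
  count_orient α v := (D.count_polygon v α).symm
  vertex_mem α := by
    obtain m | v := α
    · refine ⟨D.vtx ⟨m, 0⟩, ?_⟩
      rw [← Multiset.count_pos, count_polygon, List.count_pos_iff, orient, List.mem_ofFn]
      exact ⟨0, rfl⟩
    · exact ⟨v, D.inr_mem_polygon v⟩
  two_le_card v := by
    obtain ⟨m, hm⟩ := D.exists_inl_mem_polygon v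
    have h : ({.inl m, .inr v} : Multiset (D.Chain ⊕ V)) ≤ D.polygon v := by
      rw [Multiset.le_iff_subset (by simp)]
      intro α hα
      simp only [Multiset.insert_eq_cons, Multiset.mem_cons, Multiset.mem_singleton] at hα
      obtain rfl | rfl := hα
      · exact hm
      · exact D.inr_mem_polygon v
    simpa using Multiset.card_le_card h
  exists_nontruncated v := by
    obtain ⟨m, hm⟩ := D.exists_inl_mem_polygon v
    refine ⟨.inl m, hm, ?_⟩
    -- A maximal path of positive length has at least two places, hence valency at least two.
    rw [sum_count_polygon, length_orient_inl, mul_one]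
    exact Nat.succ_lt_succ (hD m)

variable (hD : ∀ m, 0 < D.len m)

theorem not_isTruncated_inl (m : D.Chain) : ¬ (D.brauer hD).IsTruncated (.inl m) := by
  intro h
  have h1 : (D.brauer hD).val (.inl m) = 1 := (mul_one _).symm.trans h
  have h2 := ((D.brauer hD).val_eq_length (.inl m)).trans (D.length_orient_inl m)
  exact (hD m).ne' (Nat.succ_injective (h2.symm.trans h1))

theorem isTruncated_inr (v : V) : (D.brauer hD).IsTruncated (.inr v) :=
  (mul_one _).trans ((D.brauer hD).val_eq_length (.inr v))

/-- The arrow of the Brauer configuration at a place of a maximal path. -/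
noncomputable def brauerArrow (x : D.Place) : (D.brauer hD).Arrow :=
  ⟨⟨.inl x.1, D.not_isTruncated_inl hD x.1⟩, x.2.cast (D.length_orient_inl x.1).symm⟩

theorem brauerArrow_bijective : Function.Bijective (D.brauerArrow hD) := by
  constructor
  · rintro ⟨m, i⟩ ⟨m', j⟩ h
    obtain rfl : m = m' := Sum.inl_injective (congrArg (fun y => y.1.1) h)
    have h2 := eq_of_heq (Sigma.mk.inj h).2
    obtain rfl : i = j := Fin.cast_injective _ h2
    rfl
  · rintro ⟨⟨m | v, h⟩, i⟩
    · exact ⟨⟨m, i.cast (D.length_orient_inl m)⟩, rfl⟩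
    · exact absurd (D.isTruncated_inr hD v) h

theorem next_brauerArrow (x : D.Place) :
    BrauerConfiguration.next (D.brauerArrow hD x) = D.brauerArrow hD (cycleNext x) := by
  refine Sigma.ext rfl (heq_of_eq (Fin.ext ?_))
  refine (val_finRotate _).trans ?_
  change ((x.2 : ℕ) + 1) % (D.orient (.inl x.1)).length = (finRotate (D.len x.1 + 1) x.2 : ℕ)
  rw [val_finRotate, length_orient_inl]

theorem src_brauerArrow (x : D.Place) :
    BrauerConfiguration.src (D.brauerArrow hD x) = D.vtx x := by
  exact List.get_ofFn (fun i => D.vtx ⟨x.1, i⟩) (x.2.cast (D.length_orient_inl x.1).symm)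

/-- The quiver of the Brauer configuration can be cut. -/
noncomputable def brauerCut : (D.brauer hD).cyclicQuiver.Cut I :=
  D.cut _ (Equiv.refl V) (Equiv.ofBijective _ (D.brauerArrow_bijective hD)).symm
    (fun x => by
      obtain ⟨x, rfl⟩ := (D.brauerArrow_bijective hD).2 x
      rw [Equiv.symm_apply_eq, Equiv.ofBijective_symm_apply_apply]
      exact D.next_brauerArrow hD x)
    (fun x => by
      obtain ⟨x, rfl⟩ := (D.brauerArrow_bijective hD).2 x
      rw [Equiv.ofBijective_symm_apply_apply]
      exact D.length_orient_inl x.1)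
    (fun x => by
      obtain ⟨x, rfl⟩ := (D.brauerArrow_bijective hD).2 x
      rw [Equiv.ofBijective_symm_apply_apply]
      exact D.src_brauerArrow hD x)

end ChainData

/-! ### Conclusion: the Brauer configuration algebra and the transfer to Morita equivalent algebras.
-/

/-- The trivial extension of an almost gentle presentation without isolated vertices is a Brauer
configuration algebra. -/
theorem exists_brauerConfiguration_algEquiv {K : Type u} [Field K] {V : Type u} [Quiver.{u} V]
    [Fintype V] (I : TwoSidedIdeal (PathAlgebra K V)) (hI : IsAlmostGentleIdeal I)
    (hV : ∀ v : V, ∃ w : V, Nonempty (v ⟶ w) ∨ Nonempty (w ⟶ v)) :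
    ∃ Γ : BrauerConfiguration.{u},
      Nonempty (TrivialExtension K (QuiverAlgebra I) ≃ₐ[K] Γ.algebra K) := by
  obtain ⟨D⟩ := hI.nonempty_chainData
  have hD : ∀ m, 0 < D.len m := by
    intro m
    by_contra h
    obtain ⟨w, hw⟩ := hV (D.vtx ⟨m, 0⟩)
    have hm := D.isEmpty_of_len_eq_zero ⟨m, 0⟩ (Nat.eq_zero_of_not_pos h) w
    exact hw.elim (fun h => h.elim hm.1.elim) fun h => h.elim hm.2.elim
  have hfin : Finite (D.brauer hD).Arrow := Finite.of_surjective _ (D.brauerArrow_bijective hD).2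
  have hideal := (D.brauer hD).ideal_eq K fun _ => rfl
  refine ⟨D.brauer hD, ?_⟩
  change Nonempty (_ ≃ₐ[K] QuiverAlgebra ((D.brauer hD).ideal K))
  rw [hideal]
  exact ⟨(D.brauerCut hD).algEquiv hI.quadratic⟩

/-- Let `A` be an almost gentle algebra: a finite-dimensional `K`-algebra that is Morita equivalent
to `K V / I`, where `(V, I)` is an almost gentle presentation. Then `T(A)` is symmetric and special
multiserial. If no vertex of the quiver is isolated, then `T(A)` is, up to Morita equivalence, a
Brauer configuration algebra, and `T(A)` is itself isomorphic to this Brauer configuration algebra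
when `A` is isomorphic to `K V / I`. -/
theorem corollary4p4 {K : Type u} [Field K]
    {V : Type u} [Quiver.{u} V] [Fintype V] (I : TwoSidedIdeal (PathAlgebra K V))
    (hI : IsAlmostGentleIdeal I)
    (A : Type u) [Ring A] [Algebra K A] [Module.Finite K A]
    (hA : IsMoritaEquivalent K A (QuiverAlgebra I)) :
    IsSymmetricKAlgebra K (TrivialExtension K A) ∧
    IsSpecialMultiserialAlgebra K (TrivialExtension K A) ∧
    ((∀ v : V, ∃ w : V, Nonempty (v ⟶ w) ∨ Nonempty (w ⟶ v)) →
      ∃ Γ : BrauerConfiguration.{u},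
        IsMoritaEquivalent K (TrivialExtension K A) (Γ.algebra K) ∧
        (Nonempty (A ≃ₐ[K] QuiverAlgebra I) →
          Nonempty (TrivialExtension K A ≃ₐ[K] Γ.algebra K))) := by
  have hT := hA.trivialExtension
  refine ⟨isSymmetricKAlgebra_trivialExtension K A, ?_, fun hV => ?_⟩
  · obtain ⟨W, _, _, J, hfin, hadm, hJ, hM⟩ :=
      isSpecialMultiserialAlgebra_trivialExtension I hI
    exact ⟨W, _, _, J, hfin, hadm, hJ, IsMoritaEquivalent.trans K hT hM⟩
  · obtain ⟨Γ, ⟨e⟩⟩ := exists_brauerConfiguration_algEquiv I hI hV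
    exact ⟨Γ, IsMoritaEquivalent.trans K hT (IsMoritaEquivalent.of_algEquiv K e),
      fun ⟨f⟩ => ⟨(TrivialExtension.congr f).trans e⟩⟩
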